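/- For a finite set $X\subset\mathbb R^2$ let $[X]$ be its convex hull, and let $b_X$ and $i_X$ be the numbers of points of $X$ on the boundary and in the interior of $[X]$, respectively. A triangulation of $X$ is a simplicial complex whose vertex set is exactly $X$ and whose underlying space is $[X]$. Let $A$ and $B$ be finite non-collinear sets in $\mathbb R^2$ all of whose points lie on the boundaries of their convex hulls, that is, $|A|=b_A$ and $|B|=b_B$. Then: (1) If the inequality $2i_{A+B}\ge b_A+b_B-6$ fails, then either $|A|=3$ and $B$ is a translate of $A+A$, or $|B|=3$ and $A$ is a translate of $B+B$. (2) In all cases $$\sqrt{2i_{A+B}+b_{A+B}-2}\;\ge\;\sqrt{2i_A+b_A-2}+\sqrt{2i_B+b_B-2}.$$ (3) Equivalently, $\sqrt{\mathrm{tr}(A+B)}\ge\sqrt{\mathrm{tr}(A)}+\sqrt{\mathrm{tr}(B)}$, where $\mathrm{tr}(X)$ is the common number of triangles of all triangulations of $X$; that is, for any triangulations of $A$, $B$ and $A+B$ with $t_A$, $t_B$ and $t_{A+B}$ triangles, $\sqrt{t_{A+B}}\ge\sqrt{t_A}+\sqrt{t_B}$. -/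

import Mathlib

open scoped Pointwise

/-- The Euclidean plane. -/
abbrev Plane : Type := EuclideanSpace ℝ (Fin 2)

/-- `b_A`: the number of points of `A` on the boundary of its convex hull. -/
noncomputable def boundaryCount (A : Set Plane) : ℕ :=
  (A ∩ frontier (convexHull ℝ A)).ncard

/-- `i_A`: the number of points of `A` in the interior of its convex hull. -/
noncomputable def interiorCount (A : Set Plane) : ℕ :=
  (A ∩ interior (convexHull ℝ A)).ncard

/-- `K` is a triangulation of the convex hull of `A` whose vertices are exactly the points
of `A`. -/
def IsTriangulation (A : Set Plane) (K : Geometry.SimplicialComplex ℝ Plane) : Prop :=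
  K.vertices = A ∧ K.space = convexHull ℝ A

/-- The number of triangles (two-dimensional faces) of `K`. -/
noncomputable def triangleCount (K : Geometry.SimplicialComplex ℝ Plane) : ℕ :=
  {s : Finset Plane | s ∈ K.faces ∧ s.card = 3}.ncard

/-!
Fix a direction `h`. The boundary points of `X` other than the highest and lowest ones with respect
to `h` form a left and a right chain. A point `a` of one chain of `A` and a point `b` of the
opposite chain of `B` have no outer normal in common, so `a + b` is interior to `[A + B]`; the
heights `⟪h, ·⟫` are injective on a chain, so Cauchy–Davenport on the line gives at least
`|chain A| + |chain B| - 1` such sums. If `|A|, |B| ≥ 4`, then some generic `h` makes both chains of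
the smaller set nonempty, and the better of the two pairings yields `|A| + |B| ≤ 2 i_{A+B} + 6`.

If `A` is a triangle, take `h` normal to one of its sides. The chains of `B`, translated to the ends
of that side, and the points of the faces of `B` normal to `h`, suitably translated, are all
interior to `[A + B]`. When the inequality fails, counting them is tight for each of the three
sides, which leaves a single interior point and forces `B` to be a translate of `A + A`.

Since faces add, `b_A + b_B ≤ b_{A+B}`, and the square-root inequality follows from
`(√x + √y)² ≤ 2 (x + y)`, apart from the exceptional pairs, where it reads `1 + 2 ≤ √b_{A+B}` with
`b_{A+B} ≥ 9`.

For the number of triangles, let `d` be orthogonal to a generic `h`. A triangle is entered from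
exactly one of its vertices, the middle one, in exactly one of the directions `d` and `-d`. In turn
a vertex of the triangulation enters `[X]` in direction `d` through exactly one triangle, and it
does so precisely when it is interior or on one of the two chains. Hence `t = 2 i_X + b_X - 2`.
-/

open Filter Set Topology
open scoped InnerProductSpace

lemma eventually_add_smul_mem {E : Type*} [AddCommGroup E] [Module ℝ E] [TopologicalSpace E]
    [ContinuousAdd E] [ContinuousSMul ℝ E] {x : E} {s : Set E} (hs : s ∈ 𝓝 x) (d : E) :
    ∀ᶠ t in 𝓝[>] (0 : ℝ), x + t • d ∈ s := by
  have hcont : Tendsto (fun t : ℝ ↦ x + t • d) (𝓝[>] 0) (𝓝 x) :=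
    (Continuous.tendsto' (by fun_prop) 0 x (by simp)).mono_left nhdsWithin_le_nhds
  exact hcont.eventually hs

section InnerProduct

variable {E : Type*} [NormedAddCommGroup E] [InnerProductSpace ℝ E] {A B X : Set E} {w x : E}

/-- The face of `X` exposed by `w`: the points of `X` at which `⟪w, ·⟫` is maximal. -/
def face (X : Set E) (w : E) : Set E := {x ∈ X | ∀ y ∈ X, ⟪w, y⟫_ℝ ≤ ⟪w, x⟫_ℝ}

lemma face_subset (X : Set E) (w : E) : face X w ⊆ X := fun _ hx ↦ hx.1

lemma face_nonempty (hX : X.Finite) (hne : X.Nonempty) (w : E) : (face X w).Nonempty :=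
  exists_max_image X (inner ℝ w) hX hne

lemma inner_eq_of_mem_face {y : E} (hx : x ∈ face X w) (hy : y ∈ face X w) :
    ⟪w, x⟫_ℝ = ⟪w, y⟫_ℝ :=
  le_antisymm (hy.2 x hx.1) (hx.2 y hy.1)

lemma face_smul (X : Set E) {c : ℝ} (hc : 0 < c) (w : E) : face X (c • w) = face X w := by
  ext x
  simp only [face, mem_ofPred_eq, real_inner_smul_left, mul_le_mul_iff_right₀ hc]

lemma mem_face_neg : x ∈ face X (-w) ↔ x ∈ X ∧ ∀ y ∈ X, ⟪w, x⟫_ℝ ≤ ⟪w, y⟫_ℝ := by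
  simp only [face, mem_ofPred_eq, inner_neg_left, neg_le_neg_iff]

lemma mem_face_add_smul {v : E} {s t : ℝ} (hs : 0 ≤ s) (ht : 0 ≤ t) (hv : x ∈ face X v)
    (hw : x ∈ face X w) : x ∈ face X (s • v + t • w) := by
  refine ⟨hv.1, fun y hy ↦ ?_⟩
  simp only [inner_add_left, real_inner_smul_left]
  gcongr
  exacts [hv.2 y hy, hw.2 y hy]

lemma add_mem_face_add_iff {a b : E} (ha : a ∈ A) (hb : b ∈ B) :
    a + b ∈ face (A + B) w ↔ a ∈ face A w ∧ b ∈ face B w := by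
  constructor
  · rintro ⟨-, h⟩
    refine ⟨⟨ha, fun y hy ↦ ?_⟩, ⟨hb, fun y hy ↦ ?_⟩⟩
    · simpa [inner_add_right] using h _ (add_mem_add hy hb)
    · simpa [inner_add_right] using h _ (add_mem_add ha hy)
  · rintro ⟨h₁, h₂⟩
    refine ⟨add_mem_add ha hb, ?_⟩
    rintro _ ⟨x, hx, y, hy, rfl⟩
    simpa only [inner_add_right] using add_le_add (h₁.2 x hx) (h₂.2 y hy)

lemma face_add (A B : Set E) (w : E) : face (A + B) w = face A w + face B w := by
  refine Subset.antisymm (fun x hx ↦ ?_) (add_subset_iff.2 fun a ha b hb ↦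
    (add_mem_face_add_iff ha.1 hb.1).2 ⟨ha, hb⟩)
  obtain ⟨a, ha, b, hb, rfl⟩ := hx.1
  obtain ⟨h₁, h₂⟩ := (add_mem_face_add_iff ha hb).1 hx
  exact add_mem_add h₁ h₂

lemma nonempty_of_affineSpan_eq_top (hX : affineSpan ℝ X = ⊤) : X.Nonempty :=
  (affineSpan_nonempty ℝ).1 (hX ▸ ⟨0, AffineSubspace.mem_top ℝ E 0⟩)

lemma affineSpan_add_eq_top (hA : affineSpan ℝ A = ⊤) (hB : B.Nonempty) :
    affineSpan ℝ (A + B) = ⊤ := by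
  obtain ⟨b, hb⟩ := hB
  have hsub : b +ᵥ A ⊆ A + B := by
    rintro _ ⟨a, ha, rfl⟩
    exact ⟨a, ha, b, hb, add_comm a b⟩
  refine top_unique (le_trans ?_ (affineSpan_mono ℝ hsub))
  rw [← AffineSubspace.pointwise_vadd_span, hA, AffineSubspace.pointwise_vadd_top]

lemma exists_inner_ne (hX : affineSpan ℝ X = ⊤) (hw : w ≠ 0) (c : ℝ) : ∃ x ∈ X, ⟪w, x⟫_ℝ ≠ c := by
  by_contra! h
  have hle : vectorSpan ℝ X ≤ (ℝ ∙ w)ᗮ := by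
    refine Submodule.span_le.2 ?_
    rintro _ ⟨x, hx, y, hy, rfl⟩
    simp [Submodule.mem_orthogonal_singleton_iff_inner_right, inner_sub_right, h x hx, h y hy]
  rw [← direction_affineSpan, hX, AffineSubspace.direction_top] at hle
  exact hw (inner_self_eq_zero.1
    (Submodule.mem_orthogonal_singleton_iff_inner_right.1 (hle (Submodule.mem_top (x := w)))))

lemma exists_inner_lt (hX : affineSpan ℝ X = ⊤) (hw : w ≠ 0) (hx : x ∈ face X w) :
    ∃ y ∈ X, ⟪w, y⟫_ℝ < ⟪w, x⟫_ℝ := by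
  obtain ⟨y, hy, hne⟩ := exists_inner_ne hX hw ⟪w, x⟫_ℝ
  exact ⟨y, hy, (hx.2 y hy).lt_of_ne hne⟩

lemma disjoint_face_face_neg (hX : affineSpan ℝ X = ⊤) (hw : w ≠ 0) :
    Disjoint (face X w) (face X (-w)) := by
  refine Set.disjoint_left.2 fun x hx hx' ↦ ?_
  obtain ⟨y, hy, hlt⟩ := exists_inner_lt hX hw hx
  exact hlt.not_ge ((mem_face_neg.1 hx').2 y hy)

lemma inner_le_of_mem_convexHull {c : ℝ} (h : ∀ y ∈ X, ⟪w, y⟫_ℝ ≤ c) {z : E}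
    (hz : z ∈ convexHull ℝ X) : ⟪w, z⟫_ℝ ≤ c :=
  convexHull_min h (convex_halfSpace_le (innerₛₗ ℝ w).isLinear c) hz

/-- The points of `X` in the interior of its convex hull. -/
def interiorPoints (X : Set E) : Set E := X ∩ interior (convexHull ℝ X)

/-- The points of `X` on the boundary of its convex hull. -/
def boundaryPoints (X : Set E) : Set E := X ∩ frontier (convexHull ℝ X)

lemma ncard_boundaryPoints_add_ncard_interiorPoints (hX : X.Finite) :
    (boundaryPoints X).ncard + (interiorPoints X).ncard = X.ncard := by
  have hdiff : boundaryPoints X = X \ interiorPoints X := by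
    ext x
    have hcl (hx : x ∈ X) : x ∈ closure (convexHull ℝ X) :=
      subset_closure (subset_convexHull ℝ X hx)
    simp only [boundaryPoints, interiorPoints, frontier, mem_inter_iff, Set.mem_sdiff]
    tauto
  rw [hdiff, interiorPoints, ncard_sdiff_add_ncard_of_subset inter_subset_left hX]

lemma notMem_face_of_mem_interior (hw : w ≠ 0) (hx : x ∈ interior (convexHull ℝ X)) :
    x ∉ face X w := by
  intro hf
  obtain ⟨ε, hmem, hε⟩ := ((eventually_add_smul_mem (mem_interior_iff_mem_nhds.1 hx) w).and
    self_mem_nhdsWithin).exists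
  have hle := inner_le_of_mem_convexHull hf.2 hmem
  rw [inner_add_right, real_inner_smul_right, add_le_iff_nonpos_right] at hle
  exact hle.not_gt (mul_pos hε (real_inner_self_pos.2 hw))

section FiniteDimensional

variable [FiniteDimensional ℝ E]

lemma inner_le_of_forall_interior_convexHull_lt (hX : affineSpan ℝ X = ⊤) {u : ℝ}
    (h : ∀ z ∈ interior (convexHull ℝ X), ⟪w, z⟫_ℝ < u) (hx : x ∈ X) : ⟪w, x⟫_ℝ ≤ u := by
  have hx' : x ∈ closure (interior (convexHull ℝ X)) := by
    rw [(convex_convexHull ℝ X).closure_interior_eq_closure_of_nonempty_interior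
      (interior_convexHull_nonempty_iff_affineSpan_eq_top.2 hX)]
    exact subset_closure (subset_convexHull ℝ X hx)
  have hcl : IsClosed {z : E | ⟪w, z⟫_ℝ ≤ u} := isClosed_le (by fun_prop) continuous_const
  exact closure_minimal (fun z hz ↦ (h z hz).le) hcl hx'

lemma exists_add_smul_mem_interior_convexHull (hX : affineSpan ℝ X = ⊤) (hx : x ∈ X) {d : E}
    (hd : ∀ w, w ≠ 0 → x ∈ face X w → ⟪w, d⟫_ℝ < 0) :
    ∃ ε : ℝ, 0 < ε ∧ x + ε • d ∈ interior (convexHull ℝ X) := by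
  have := FiniteDimensional.complete ℝ E
  by_contra! hray
  have hdisj : Disjoint (interior (convexHull ℝ X)) ((fun t : ℝ ↦ x + t • d) '' Ioi 0) := by
    refine disjoint_right.2 ?_
    rintro _ ⟨t, ht, rfl⟩
    exact hray t ht
  have hconvex : Convex ℝ ((fun t : ℝ ↦ x + t • d) '' Ioi 0) := by
    have := ((convex_Ioi (0 : ℝ)).linear_image (LinearMap.toSpanSingleton ℝ E d)).translate x
    simpa only [image_image, LinearMap.toSpanSingleton_apply] using this
  obtain ⟨f, u, hlt, hge⟩ := geometric_hahn_banach_open (convex_convexHull ℝ X).interior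
    isOpen_interior hconvex hdisj
  obtain ⟨w, rfl⟩ := (InnerProductSpace.toDual ℝ E).surjective f
  simp only [InnerProductSpace.toDual_apply_apply, forall_mem_image, mem_Ioi, inner_add_right,
    real_inner_smul_right] at hlt hge
  have hux : u ≤ ⟪w, x⟫_ℝ := by
    have hlim : Tendsto (fun t ↦ ⟪w, x⟫_ℝ + t * ⟪w, d⟫_ℝ) (𝓝[>] 0) (𝓝 ⟪w, x⟫_ℝ) :=
      (Continuous.tendsto' (by fun_prop) 0 _ (by simp)).mono_left nhdsWithin_le_nhds
    exact ge_of_tendsto hlim (eventually_nhdsWithin_of_forall fun t ht ↦ hge ht)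
  have hw : w ≠ 0 := by
    rintro rfl
    obtain ⟨z, hz⟩ := interior_convexHull_nonempty_iff_affineSpan_eq_top.2 hX
    simpa using (hlt z hz).trans_le (hge one_pos)
  have hle {y : E} (hy : y ∈ X) : ⟪w, y⟫_ℝ ≤ u :=
    inner_le_of_forall_interior_convexHull_lt hX hlt hy
  have hwd := hd w hw ⟨hx, fun y hy ↦ (hle hy).trans hux⟩
  linarith [hge one_pos, hle hx]

lemma exists_mem_face_of_notMem_interior (hX : affineSpan ℝ X = ⊤) (hx : x ∈ X)
    (hn : x ∉ interior (convexHull ℝ X)) : ∃ w, w ≠ 0 ∧ x ∈ face X w := by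
  by_contra! hface
  obtain ⟨ε, -, hmem⟩ := exists_add_smul_mem_interior_convexHull hX hx (d := 0)
    fun w hw hf ↦ absurd hf (hface w hw)
  exact hn (by simpa using hmem)

lemma mem_interiorPoints_iff (hX : affineSpan ℝ X = ⊤) (hx : x ∈ X) :
    x ∈ interiorPoints X ↔ ∀ w, w ≠ 0 → x ∉ face X w := by
  refine ⟨fun h w hw ↦ notMem_face_of_mem_interior hw h.2, fun h ↦ ⟨hx, ?_⟩⟩
  by_contra hn
  obtain ⟨w, hw, hf⟩ := exists_mem_face_of_notMem_interior hX hx hn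
  exact h w hw hf

lemma mem_boundaryPoints_iff (hX : affineSpan ℝ X = ⊤) :
    x ∈ boundaryPoints X ↔ ∃ w, w ≠ 0 ∧ x ∈ face X w := by
  constructor
  · exact fun h ↦ exists_mem_face_of_notMem_interior hX h.1 h.2.2
  · rintro ⟨w, hw, hf⟩
    exact ⟨hf.1, subset_closure (subset_convexHull ℝ X hf.1),
      fun h ↦ notMem_face_of_mem_interior hw h hf⟩

lemma add_mem_interiorPoints (hA : affineSpan ℝ A = ⊤) {a b : E} (ha : a ∈ A) (hb : b ∈ B)
    (h : ∀ w, w ≠ 0 → a ∈ face A w → b ∉ face B w) : a + b ∈ interiorPoints (A + B) := by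
  rw [mem_interiorPoints_iff (affineSpan_add_eq_top hA ⟨b, hb⟩) (add_mem_add ha hb)]
  intro w hw hf
  obtain ⟨h₁, h₂⟩ := (add_mem_face_add_iff ha hb).1 hf
  exact h w hw h₁ h₂

end FiniteDimensional

lemma ncard_add_ncard_le_of_injOn_inner {P Q : Set E} (hP : P.Finite) (hQ : Q.Finite)
    (hP₀ : P.Nonempty) (hQ₀ : Q.Nonempty) (hPw : P.InjOn (inner ℝ w)) (hQw : Q.InjOn (inner ℝ w)) :
    P.ncard + Q.ncard ≤ (P + Q).ncard + 1 := by
  classical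
  lift P to Finset E using hP
  lift Q to Finset E using hQ
  have hcd := cauchy_davenport_add_of_linearOrder_isCancelAdd
    (s := P.image (inner ℝ w)) (t := Q.image (inner ℝ w)) (by simpa using hP₀) (by simpa using hQ₀)
  have himage : P.image (inner ℝ w) + Q.image (inner ℝ w) = (P + Q).image (inner ℝ w) :=
    (Finset.image_add (innerₛₗ ℝ w)).symm
  rw [Finset.card_image_of_injOn hPw, Finset.card_image_of_injOn hQw, himage] at hcd
  have hle := Finset.card_image_le (s := P + Q) (f := inner ℝ w)
  rw [← Finset.coe_add, ncard_coe_finset, ncard_coe_finset, ncard_coe_finset]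
  omega

lemma injOn_inner_vadd (hX : X.InjOn (inner ℝ w)) (v : E) :
    (v +ᵥ X).InjOn (inner ℝ w) := by
  rintro _ ⟨b, hb, rfl⟩ _ ⟨c, hc, rfl⟩ hbc
  simp only [vadd_eq_add, inner_add_right, add_right_inj] at hbc
  simp only [hX hb hc hbc]

lemma injOn_inner_neg (h : X.InjOn (inner ℝ w)) : X.InjOn (inner ℝ (-w)) :=
  fun x hx y hy hxy ↦ h hx hy (by simpa using hxy)

lemma ncard_face_eq_one (hX : X.Finite) (hne : X.Nonempty) (h : X.InjOn (inner ℝ w)) :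
    (face X w).ncard = 1 := by
  obtain ⟨x, hx⟩ := face_nonempty hX hne w
  refine ncard_eq_one.2 ⟨x, eq_singleton_iff_unique_mem.2 ⟨hx, fun y hy ↦ ?_⟩⟩
  exact h hy.1 hx.1 (inner_eq_of_mem_face hy hx)

lemma dense_setOf_inner_ne_zero {v : E} (hv : v ≠ 0) : Dense {w : E | ⟪w, v⟫_ℝ ≠ 0} := by
  have hcompl : {w : E | ⟪w, v⟫_ℝ ≠ 0} = ((ℝ ∙ v)ᗮ : Set E)ᶜ := by
    ext w
    simp [Submodule.mem_orthogonal_singleton_iff_inner_left]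
  rw [hcompl, ← interior_eq_empty_iff_dense_compl]
  by_contra hne
  have htop := Submodule.eq_top_of_nonempty_interior' _ (nonempty_iff_ne_empty.2 hne)
  exact hv (by simpa using htop)

lemma dense_setOf_injOn_inner [CompleteSpace E] (hX : X.Countable) :
    Dense {w : E | X.InjOn (inner ℝ w)} := by
  have hinter : {w : E | X.InjOn (inner ℝ w)} =
      ⋂ p ∈ X.offDiag, {w : E | ⟪w, p.1 - p.2⟫_ℝ ≠ 0} := by
    ext w
    simp only [mem_ofPred_eq, mem_iInter, mem_offDiag, and_imp, Prod.forall, inner_sub_right,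
      sub_ne_zero]
    exact ⟨fun h x y hx hy hxy he ↦ hxy (h hx hy he),
      fun h x hx y hy he ↦ by_contra fun hxy ↦ h x y hx hy hxy he⟩
  rw [hinter]
  refine dense_biInter_of_isOpen (fun p _ ↦ ?_) ((hX.prod hX).mono (offDiag_subset_prod X))
    fun p hp ↦ dense_setOf_inner_ne_zero (sub_ne_zero.2 hp.2.2)
  exact isOpen_ne_fun (by fun_prop) continuous_const

end InnerProduct

/-! ### Rays entering a convex hull -/

section EnterSet

variable {E : Type*} [AddCommGroup E] [Module ℝ E] {s t : Set E} {d x : E}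

/-- The points `x` of `s` such that the ray from `x` in direction `d` starts inside the convex hull
of `s`. -/
def enterSet (s : Set E) (d : E) : Set E := {x ∈ s | ∃ ε : ℝ, 0 < ε ∧ x + ε • d ∈ convexHull ℝ s}

lemma enterSet_subset (s : Set E) (d : E) : enterSet s d ⊆ s := fun _ hx ↦ hx.1

lemma enterSet_mono (hst : s ⊆ t) (d : E) : enterSet s d ⊆ enterSet t d := by
  rintro x ⟨hx, ε, hε, hmem⟩
  exact ⟨hst hx, ε, hε, convexHull_mono hst hmem⟩

lemma add_smul_mem_convexHull {δ ε : ℝ} (hx : x ∈ s) (hmem : x + ε • d ∈ convexHull ℝ s)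
    (hδ : 0 < δ) (hδε : δ ≤ ε) : x + δ • d ∈ convexHull ℝ s := by
  have hε := hδ.trans_le hδε
  have h := (convex_convexHull ℝ s).add_smul_mem (subset_convexHull ℝ s hx) hmem
    (t := δ / ε) ⟨by positivity, (div_le_one hε).2 hδε⟩
  rwa [smul_smul, div_mul_cancel₀ _ hε.ne'] at h

section SimplicialComplex

variable {K : Geometry.SimplicialComplex ℝ E}

lemma enterSet_inter_enterSet_subset {s t : Finset E} (hs : s ∈ K.faces) (ht : t ∈ K.faces)
    (d : E) : enterSet (s : Set E) d ∩ enterSet (t : Set E) d ⊆ enterSet (s ∩ t : Set E) d := by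
  rintro x ⟨⟨hxs, ε, hε, hmem⟩, hxt, δ, hδ, hmem'⟩
  exact ⟨⟨hxs, hxt⟩, min ε δ, lt_min hε hδ, K.inter_subset_convexHull hs ht
    ⟨add_smul_mem_convexHull hxs hmem (lt_min hε hδ) (min_le_left _ _),
      add_smul_mem_convexHull hxt hmem' (lt_min hε hδ) (min_le_right _ _)⟩⟩

lemma coe_subset_vertices {s : Finset E} (hs : s ∈ K.faces) : (s : Set E) ⊆ K.vertices := by
  rw [K.vertices_eq]
  exact subset_biUnion_of_mem (u := fun k : Finset E ↦ (k : Set E)) hs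

lemma finite_faces (hK : K.vertices.Finite) : K.faces.Finite := by
  refine (hK.toFinset.powerset.finite_toSet).subset fun s hs ↦ ?_
  simpa [← Finset.coe_subset] using coe_subset_vertices hs

lemma exists_mem_enterSet_of_mem_enterSet_vertices [TopologicalSpace E] [IsTopologicalAddGroup E]
    [ContinuousSMul ℝ E] [T2Space E] (hfin : K.vertices.Finite)
    (hK : K.space = convexHull ℝ K.vertices) (hx : x ∈ enterSet K.vertices d) :
    ∃ s ∈ K.faces, x ∈ enterSet (s : Set E) d := by
  obtain ⟨hxK, ε, hε, hmem⟩ := hx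
  let C := ⋃ s ∈ {s ∈ K.faces | x ∉ convexHull ℝ (s : Set E)}, convexHull ℝ (s : Set E)
  have hC : IsClosed C := ((finite_faces hfin).subset (sep_subset _ _)).isClosed_biUnion
    fun s _ ↦ s.finite_toSet.isClosed_convexHull ℝ
  have hxC : x ∉ C := by
    simp only [C, mem_iUnion, not_exists]
    exact fun s hs ↦ hs.2
  obtain ⟨δ, hδC, hδ, hδε⟩ := ((eventually_add_smul_mem (hC.isOpen_compl.mem_nhds hxC) d).and
    (Ioc_mem_nhdsGT hε)).exists
  obtain ⟨s, hs, hδs⟩ := K.mem_space_iff.1 (hK ▸ add_smul_mem_convexHull hxK hmem hδ hδε)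
  have hxs : x ∈ convexHull ℝ (s : Set E) := by
    by_contra hxs
    exact hδC (mem_biUnion (show s ∈ {s ∈ K.faces | _} from ⟨hs, hxs⟩) hδs)
  exact ⟨s, hs, (K.vertex_mem_convexHull_iff hxK hs).1 hxs, δ, hδ, hδs⟩

end SimplicialComplex

end EnterSet

section InnerProduct

variable {E : Type*} [NormedAddCommGroup E] [InnerProductSpace ℝ E] {X : Set E} {d w x : E}

lemma eq_of_mem_face_of_inner_le (hX : X.InjOn (inner ℝ w)) (hx : x ∈ face X w) {z : E}
    (hz : z ∈ convexHull ℝ X) (hle : ⟪w, x⟫_ℝ ≤ ⟪w, z⟫_ℝ) : z = x := by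
  rcases (X \ {x}).eq_empty_or_nonempty with hempty | hne
  · simpa using convexHull_mono (sdiff_eq_bot_iff.1 hempty) hz
  have hlt (y : E) (hy : y ∈ convexHull ℝ (X \ {x})) : ⟪w, y⟫_ℝ < ⟪w, x⟫_ℝ :=
    convexHull_min (fun y hy ↦ (hx.2 y hy.1).lt_of_ne fun h ↦ hy.2 (hX hy.1 hx.1 h))
      (convex_halfSpace_lt (innerₛₗ ℝ w).isLinear _) hy
  rw [← insert_sdiff_self_of_mem hx.1, convexHull_insert hne, convexJoin_singleton_left] at hz
  simp only [mem_iUnion, exists_prop] at hz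
  obtain ⟨y, hy, a, b, -, hb, hab, rfl⟩ := hz
  obtain rfl : a = 1 - b := by linarith
  have hb₀ : b = 0 := by
    simp only [inner_add_right, real_inner_smul_right] at hle
    nlinarith [hlt y hy]
  simp [hb₀]

lemma notMem_face_of_mem_enterSet (hX : X.InjOn (inner ℝ w)) (hd : d ≠ 0) (hwd : ⟪w, d⟫_ℝ = 0)
    (hx : x ∈ enterSet X d) : x ∉ face X w := by
  obtain ⟨-, ε, hε, hmem⟩ := hx
  intro hf
  have heq := eq_of_mem_face_of_inner_le hX hf hmem
    (by rw [inner_add_right, real_inner_smul_right, hwd, mul_zero, add_zero])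
  simp [hε.ne', hd] at heq

lemma two_lt_ncard_of_mem_enterSet (hfin : X.Finite) (hX : X.InjOn (inner ℝ w)) (hd : d ≠ 0)
    (hwd : ⟪w, d⟫_ℝ = 0) (hx : x ∈ enterSet X d) : 2 < X.ncard := by
  have hhigh := notMem_face_of_mem_enterSet hX hd hwd hx
  have hlow := notMem_face_of_mem_enterSet (injOn_inner_neg hX) hd (by simp [hwd]) hx
  simp only [face, mem_ofPred_eq, not_and, not_forall, not_le, exists_prop, inner_neg_left,
    neg_lt_neg_iff] at hhigh hlow
  obtain ⟨a, ha, hxa⟩ := hhigh hx.1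
  obtain ⟨b, hb, hbx⟩ := hlow hx.1
  refine (two_lt_ncard hfin).2 ⟨a, ha, b, hb, x, hx.1, ?_, ?_, ?_⟩ <;> rintro rfl <;> linarith

lemma interiorPoints_range_affineBasis {ι : Type*} [Finite ι] [Nontrivial ι]
    (b : AffineBasis ι ℝ E) : interiorPoints (range b) = ∅ := by
  refine eq_empty_of_forall_notMem ?_
  rintro _ ⟨⟨i, rfl⟩, hi⟩
  rw [b.interior_convexHull] at hi
  obtain ⟨j, hji⟩ := exists_ne i
  exact (hi j).ne' (b.coord_apply_ne hji)

end InnerProduct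

lemma three_le_ncard_of_not_collinear {k W P : Type*} [DivisionRing k] [AddCommGroup W]
    [Module k W] [AddTorsor W P] {X : Set P} (hX : ¬ Collinear k X) (hfin : X.Finite) :
    3 ≤ X.ncard := by
  by_contra! hlt
  obtain h | h | h : X.ncard = 0 ∨ X.ncard = 1 ∨ X.ncard = 2 := by omega
  · exact hX ((ncard_eq_zero hfin).1 h ▸ collinear_empty k P)
  · obtain ⟨x, rfl⟩ := ncard_eq_one.1 h
    exact hX (collinear_singleton k x)
  · obtain ⟨x, y, -, rfl⟩ := ncard_eq_two.1 h
    exact hX (collinear_pair k x y)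

lemma ncard_triple_add_self_le {G : Type*} [AddCommGroup G] (x y z : G) :
    (({x, y, z} : Set G) + {x, y, z}).ncard ≤ 6 := by
  classical
  have hsub : ({x, y, z} : Set G) + {x, y, z} ⊆
      (({x + x, y + y, z + z, x + y, y + z, z + x} : Finset G) : Set G) := by
    rintro _ ⟨a, ha, b, hb, rfl⟩
    simp only [mem_insert_iff, mem_singleton_iff] at ha hb
    rcases ha with rfl | rfl | rfl <;> rcases hb with rfl | rfl | rfl <;> simp [add_comm]
  refine (ncard_le_ncard hsub (Finset.finite_toSet _)).trans ?_
  rw [ncard_coe_finset]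
  exact Finset.card_le_six

lemma sqrt_add_sqrt_le_sqrt {x y z : ℝ} (hx : 0 ≤ x) (hy : 0 ≤ y) (h : 2 * (x + y) ≤ z) :
    √x + √y ≤ √z := by
  refine Real.le_sqrt_of_sq_le (add_sq_le.trans ?_)
  rwa [Real.sq_sqrt hx, Real.sq_sqrt hy]

section ExceptionalPair

variable {E : Type*} [NormedAddCommGroup E] [InnerProductSpace ℝ E] {A B : Set E}

/-- The exceptional pairs: `A` is a triangle and `B` is a translate of `A + A`. The last two fields
record the resulting numbers of points. -/
structure IsExceptionalPair (A B : Set E) : Prop where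
  ncard_left : A.ncard = 3
  exists_eq_vadd : ∃ t : E, B = t +ᵥ (A + A)
  ncard_right : B.ncard = 6
  ncard_interiorPoints : (interiorPoints (A + B)).ncard = 1

lemma IsExceptionalPair.sqrt_add_sqrt_le (h : IsExceptionalPair A B)
    (hb : A.ncard + B.ncard ≤ (boundaryPoints (A + B)).ncard) :
    √((A.ncard : ℝ) - 2) + √((B.ncard : ℝ) - 2) ≤
      √(2 * ((interiorPoints (A + B)).ncard : ℝ) + (boundaryPoints (A + B)).ncard - 2) := by
  rw [h.ncard_left, h.ncard_right] at hb ⊢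
  rw [h.ncard_interiorPoints]
  have hb' : (9 : ℝ) ≤ (boundaryPoints (A + B)).ncard := by exact_mod_cast hb
  have h₁ : √(((3 : ℕ) : ℝ) - 2) = 1 := Real.sqrt_eq_one.2 (by norm_num)
  have h₂ : √(((6 : ℕ) : ℝ) - 2) = 2 := (Real.sqrt_eq_iff_mul_self_eq (by norm_num) two_pos.le).2
    (by norm_num)
  rw [h₁, h₂]
  exact Real.le_sqrt_of_sq_le (by push_cast; linarith)

end ExceptionalPair

/-! ### Chains and edges in the plane -/

section Planar

variable {V : Type*} [NormedAddCommGroup V] [InnerProductSpace ℝ V]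
  [Fact (Module.finrank ℝ V = 2)] (o : Orientation ℝ V (Fin 2)) {A B X : Set V} {f g h x y : V}

attribute [local instance] FiniteDimensional.of_fact_finrank_eq_two

local notation "J" => o.rightAngleRotation
local notation "ω" => o.areaForm

/-- Orientations exist in dimension two; this fixes one. -/
noncomputable def someOrientation (V : Type*) [NormedAddCommGroup V] [InnerProductSpace ℝ V]
    [Fact (Module.finrank ℝ V = 2)] : Orientation ℝ V (Fin 2) :=
  (Module.finBasisOfFinrankEq ℝ V Fact.out).orientation

lemma exists_eq_smul_rightAngleRotation (hh : h ≠ 0) (hx : ⟪h, x⟫_ℝ = 0) :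
    ∃ c : ℝ, x = c • J h := by
  have hpos : ‖h‖ ^ 2 ≠ 0 := by positivity
  refine ⟨ω h x / ‖h‖ ^ 2, ext_inner_left ℝ fun y ↦ ?_⟩
  have hmul := o.inner_mul_inner_add_areaForm_mul_areaForm h y x
  rw [hx, mul_zero, zero_add] at hmul
  rw [real_inner_smul_right, o.inner_rightAngleRotation_right, o.areaForm_swap y h, neg_neg,
    div_mul_eq_mul_div, eq_div_iff hpos]
  linarith

lemma exists_eq_smul_of_areaForm_eq_zero (hh : h ≠ 0) (hf : ω h f = 0) : ∃ c : ℝ, f = c • h := by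
  rw [← o.inner_rightAngleRotation_left] at hf
  obtain ⟨c, hc⟩ := exists_eq_smul_rightAngleRotation o (by simpa using hh) hf
  exact ⟨-c, by rw [hc, o.rightAngleRotation_rightAngleRotation, smul_neg, neg_smul]⟩

lemma ne_zero_of_areaForm_ne_zero (hf : ω h f ≠ 0) : f ≠ 0 :=
  fun h₀ ↦ hf (by rw [h₀, map_zero])

lemma eq_of_inner_eq (hfg : ω f g ≠ 0) (hf : ⟪f, x⟫_ℝ = ⟪f, y⟫_ℝ) (hg : ⟪g, x⟫_ℝ = ⟪g, y⟫_ℝ) :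
    x = y := by
  have hf₀ : f ≠ 0 := fun h₀ ↦ hfg (by rw [h₀, map_zero, LinearMap.zero_apply])
  obtain ⟨c, hc⟩ := exists_eq_smul_rightAngleRotation o hf₀
    (by rw [inner_sub_right, hf, sub_self] : ⟪f, x - y⟫_ℝ = 0)
  have hc₀ : c * ω f g = 0 := by
    rw [o.areaForm_swap, ← o.inner_rightAngleRotation_right, ← real_inner_smul_right, ← hc,
      inner_sub_right, hg, sub_self]
  rw [(mul_eq_zero.1 hc₀).resolve_right hfg, zero_smul] at hc
  exact sub_eq_zero.1 hc

lemma eq_zero_of_mem_face (hh : h ≠ 0) (h₁ : x ∉ face X h) (h₂ : x ∉ face X (-h))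
    (hg : x ∈ face X g) (h₀ : ω h g = 0) : g = 0 := by
  obtain ⟨c, rfl⟩ := exists_eq_smul_of_areaForm_eq_zero o hh h₀
  rcases lt_trichotomy c 0 with hc | rfl | hc
  · rw [← neg_smul_neg, face_smul X (neg_pos.2 hc)] at hg
    exact absurd hg h₂
  · exact zero_smul ℝ h
  · rw [face_smul X hc] at hg
    exact absurd hg h₁

/-- The boundary points of `X`, other than the highest and the lowest ones with respect to `h`,
that lie on the side of `J h`, where `J` is the rotation by `π / 2`. The opposite chain is
obtained by reversing the orientation. -/
def chain (X : Set V) (h : V) : Set V :=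
  {x ∈ X | x ∉ face X h ∧ x ∉ face X (-h) ∧ ∃ f, x ∈ face X f ∧ 0 < ω h f}

lemma chain_subset (X : Set V) (h : V) : chain o X h ⊆ X := fun _ hx ↦ hx.1

variable {o}

lemma areaForm_pos_of_mem_chain (hX : affineSpan ℝ X = ⊤) (hh : h ≠ 0) (hx : x ∈ chain o X h)
    (hg : x ∈ face X g) (hg₀ : g ≠ 0) : 0 < ω h g := by
  obtain ⟨-, h₁, h₂, f, hf, hfpos⟩ := hx
  by_contra! hle
  have hmem := mem_face_add_smul hfpos.le (neg_nonneg.2 hle) hg hf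
  have hzero : ω h f • g + (-ω h g) • f = 0 := by
    refine eq_zero_of_mem_face o hh h₁ h₂ hmem ?_
    simp only [map_add, map_smul, smul_eq_mul]
    ring
  obtain ⟨y, hy, hlt⟩ := exists_inner_lt hX hg₀ hg
  have hsum := congrArg (⟪·, x - y⟫_ℝ) hzero
  simp only [inner_add_left, real_inner_smul_left, inner_zero_left, inner_sub_right] at hsum
  nlinarith [mul_pos hfpos (sub_pos.2 hlt),
    mul_nonneg (neg_nonneg.2 hle) (sub_nonneg.2 (hf.2 y hy))]

lemma areaForm_neg_of_mem_chain_neg (hX : affineSpan ℝ X = ⊤) (hh : h ≠ 0)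
    (hx : x ∈ chain (-o) X h) (hg : x ∈ face X g) (hg₀ : g ≠ 0) : ω h g < 0 := by
  simpa [o.areaForm_neg_orientation] using areaForm_pos_of_mem_chain hX hh hx hg hg₀

lemma disjoint_chain_chain_neg (hX : affineSpan ℝ X = ⊤) (hh : h ≠ 0) :
    Disjoint (chain o X h) (chain (-o) X h) := by
  refine Set.disjoint_left.2 fun x hx hx' ↦ ?_
  obtain ⟨-, -, -, f, hf, hfpos⟩ := hx
  exact (areaForm_neg_of_mem_chain_neg hX hh hx' hf
    (ne_zero_of_areaForm_ne_zero o hfpos.ne')).not_gt hfpos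

lemma nonpos_of_sub_eq_smul {c : ℝ} (hx : x ∈ X) (hy : y ∈ chain o X h)
    (hc : x - y = c • J h) : c ≤ 0 := by
  obtain ⟨-, -, -, f, hf, hfpos⟩ := hy
  have hle := sub_nonpos.2 (hf.2 x hx)
  rw [← inner_sub_right, hc, real_inner_smul_right, o.inner_rightAngleRotation_right,
    ← o.areaForm_swap] at hle
  exact nonpos_of_mul_nonpos_left hle hfpos

lemma injOn_inner_chain (X : Set V) (hh : h ≠ 0) : (chain o X h).InjOn (inner ℝ h) := by
  intro x hx y hy hxy
  obtain ⟨c, hc⟩ := exists_eq_smul_rightAngleRotation o hh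
    (by rw [inner_sub_right, hxy, sub_self] : ⟪h, x - y⟫_ℝ = 0)
  have hc₁ := nonpos_of_sub_eq_smul hx.1 hy hc
  have hc₂ := nonpos_of_sub_eq_smul (c := -c) hy.1 hx (by rw [neg_smul, ← hc, neg_sub])
  rw [le_antisymm hc₁ (by linarith), zero_smul] at hc
  exact sub_eq_zero.1 hc

lemma boundaryPoints_eq_union (hX : affineSpan ℝ X = ⊤) (hh : h ≠ 0) :
    boundaryPoints X = face X h ∪ face X (-h) ∪ chain o X h ∪ chain (-o) X h := by
  ext x
  rw [mem_boundaryPoints_iff hX]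
  constructor
  · rintro ⟨w, hw, hxw⟩
    by_cases h₁ : x ∈ face X h
    · simp [h₁]
    by_cases h₂ : x ∈ face X (-h)
    · simp [h₂]
    rcases lt_trichotomy (ω h w) 0 with hneg | hzero | hpos
    · exact Or.inr ⟨hxw.1, h₁, h₂, w, hxw, by simpa [o.areaForm_neg_orientation] using hneg⟩
    · exact absurd (eq_zero_of_mem_face o hh h₁ h₂ hxw hzero) hw
    · exact Or.inl (Or.inr ⟨hxw.1, h₁, h₂, w, hxw, hpos⟩)
  · rintro (((hx | hx) | ⟨-, -, -, f, hx, hf⟩) | ⟨-, -, -, f, hx, hf⟩)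
    · exact ⟨h, hh, hx⟩
    · exact ⟨-h, neg_ne_zero.2 hh, hx⟩
    · exact ⟨f, ne_zero_of_areaForm_ne_zero o hf.ne', hx⟩
    · exact ⟨f, ne_zero_of_areaForm_ne_zero (-o) hf.ne', hx⟩

variable (o)

lemma ncard_boundaryPoints (hX : affineSpan ℝ X = ⊤) (hfin : X.Finite) (hh : h ≠ 0) :
    (boundaryPoints X).ncard = (face X h).ncard + (face X (-h)).ncard +
      (chain o X h).ncard + (chain (-o) X h).ncard := by
  have hface (w : V) : (face X w).Finite := hfin.subset (face_subset X w)
  have hchain (o' : Orientation ℝ V (Fin 2)) : (chain o' X h).Finite :=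
    hfin.subset (chain_subset o' X h)
  have hdisj (o' : Orientation ℝ V (Fin 2)) :
      Disjoint (face X h ∪ face X (-h)) (chain o' X h) := by
    refine Set.disjoint_left.2 ?_
    rintro x (hx | hx) hx'
    exacts [hx'.2.1 hx, hx'.2.2.1 hx]
  rw [boundaryPoints_eq_union (o := o) hX hh,
    ncard_union_eq _ (((hface _).union (hface _)).union (hchain _)) (hchain _),
    ncard_union_eq (hdisj o) ((hface _).union (hface _)) (hchain _),
    ncard_union_eq (disjoint_face_face_neg hX hh) (hface _) (hface _)]
  exact disjoint_union_left.2 ⟨hdisj (-o), disjoint_chain_chain_neg hX hh⟩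

/-- The points of the edge of `X` with outer normal `g`, other than its last one in
counterclockwise order. Every boundary point lies on exactly one such half-open edge. -/
def openFace (X : Set V) (g : V) : Set V := {x ∈ face X g | ∃ y ∈ face X g, ω g x < ω g y}

lemma openFace_subset_face (X : Set V) (g : V) : openFace o X g ⊆ face X g := fun _ hx ↦ hx.1

lemma openFace_smul (X : Set V) {c : ℝ} (hc : 0 < c) (g : V) :
    openFace o X (c • g) = openFace o X g := by
  ext x
  simp only [openFace, mem_ofPred_eq, face_smul X hc, map_smul, LinearMap.smul_apply, smul_eq_mul,
    mul_lt_mul_iff_right₀ hc]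

lemma exists_mem_openFace_add_smul (hfin : X.Finite) (hf : x ∈ face X f)
    (hy : ∃ y ∈ X, ω f x < ω f y) : ∃ s : ℝ, x ∈ openFace o X (f + s • J f) := by
  -- The slope `s` of the first edge met when the supporting line turns counterclockwise about `x`.
  obtain ⟨y, ⟨hyX, hxy⟩, hmin⟩ := exists_min_image {y ∈ X | ω f x < ω f y}
    (fun y ↦ (⟪f, x⟫_ℝ - ⟪f, y⟫_ℝ) / (ω f y - ω f x)) (hfin.subset (sep_subset _ _)) hy
  set s := (⟪f, x⟫_ℝ - ⟪f, y⟫_ℝ) / (ω f y - ω f x)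
  have hs₀ : 0 ≤ s := div_nonneg (sub_nonneg.2 (hf.2 y hyX)) (sub_pos.2 hxy).le
  have hsy : s * (ω f y - ω f x) = ⟪f, x⟫_ℝ - ⟪f, y⟫_ℝ := div_mul_cancel₀ _ (sub_pos.2 hxy).ne'
  have hinner (z : V) : ⟪f + s • J f, z⟫_ℝ = ⟪f, z⟫_ℝ + s * ω f z := by
    rw [inner_add_left, real_inner_smul_left, o.inner_rightAngleRotation_left]
  have harea (z : V) : ω (f + s • J f) z = ω f z - s * ⟪f, z⟫_ℝ := by
    simp only [map_add, map_smul, LinearMap.add_apply, LinearMap.smul_apply, smul_eq_mul,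
      o.areaForm_rightAngleRotation_left]
    ring
  have hle (z : V) (hz : z ∈ X) : ⟪f + s • J f, z⟫_ℝ ≤ ⟪f + s • J f, x⟫_ℝ := by
    rw [hinner, hinner]
    by_cases hxz : ω f x < ω f z
    · have hslope := hmin z ⟨hz, hxz⟩
      rw [le_div_iff₀ (sub_pos.2 hxz)] at hslope
      linarith
    · linarith [mul_le_mul_of_nonneg_left (not_lt.1 hxz) hs₀, hf.2 z hz]
  have heq : ⟪f + s • J f, x⟫_ℝ = ⟪f + s • J f, y⟫_ℝ := by
    rw [hinner, hinner]
    linarith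
  refine ⟨s, ⟨hf.1, hle⟩, y, ⟨hyX, fun z hz ↦ (hle z hz).trans heq.le⟩, ?_⟩
  rw [harea, harea]
  linarith [mul_le_mul_of_nonneg_left (hf.2 y hyX) hs₀]

lemma exists_mem_openFace (hX : affineSpan ℝ X = ⊤) (hfin : X.Finite) (hx : x ∈ boundaryPoints X) :
    ∃ u : Metric.sphere (0 : V) 1, x ∈ openFace o X u := by
  obtain ⟨f, hf₀, hf⟩ := (mem_boundaryPoints_iff hX).1 hx
  suffices ∃ g, g ≠ 0 ∧ x ∈ openFace o X g by
    obtain ⟨g, hg₀, hg⟩ := this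
    refine ⟨⟨‖g‖⁻¹ • g, by simp [norm_smul, hg₀]⟩, ?_⟩
    rwa [openFace_smul o X (by positivity)]
  have hne (k : V) (s : ℝ) (hk : k ≠ 0) : k + s • J k ≠ 0 := fun hzero ↦ hk <| by
    have hinner := congrArg (⟪k, ·⟫_ℝ) hzero
    simpa [inner_add_right, real_inner_smul_right] using hinner
  by_cases hy : ∃ y ∈ X, ω f x < ω f y
  · obtain ⟨s, hs⟩ := exists_mem_openFace_add_smul o hfin hf hy
    exact ⟨_, hne f s hf₀, hs⟩
  · push Not at hy
    have hJf : x ∈ face X (J f) :=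
      ⟨hx.1, by simpa only [o.inner_rightAngleRotation_left] using hy⟩
    obtain ⟨y, hyX, hlt⟩ := exists_inner_lt hX hf₀ hf
    obtain ⟨s, hs⟩ := exists_mem_openFace_add_smul o hfin hJf
      ⟨y, hyX, by simpa only [o.areaForm_rightAngleRotation_left, neg_lt_neg_iff] using hlt⟩
    exact ⟨_, hne (J f) s (by simpa using hf₀), hs⟩

variable {o} in
lemma areaForm_nonpos_of_mem_openFace (hx : x ∈ openFace o X g) (hf : x ∈ face X f) :
    ω g f ≤ 0 := by
  obtain ⟨hxg, y, hyg, hxy⟩ := hx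
  have hg₀ : g ≠ 0 := by
    rintro rfl
    simp at hxy
  obtain ⟨c, hc⟩ := exists_eq_smul_rightAngleRotation o hg₀
    (by rw [inner_sub_right, inner_eq_of_mem_face hxg hyg, sub_self] : ⟪g, y - x⟫_ℝ = 0)
  have hcpos : 0 < c := by
    have harea : ω g (y - x) = c * ⟪g, g⟫_ℝ := by
      rw [hc, map_smul, o.areaForm_rightAngleRotation_right, smul_eq_mul]
    rw [map_sub] at harea
    exact pos_of_mul_pos_left (harea ▸ sub_pos.2 hxy) real_inner_self_nonneg
  have hle := sub_nonpos.2 (hf.2 y hyg.1)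
  rw [← inner_sub_right, hc, real_inner_smul_right, o.inner_rightAngleRotation_right,
    ← o.areaForm_swap] at hle
  exact nonpos_of_mul_nonpos_right hle hcpos

lemma pairwise_disjoint_openFace (hX : affineSpan ℝ X = ⊤) :
    Pairwise fun u v : Metric.sphere (0 : V) 1 ↦ Disjoint (openFace o X u) (openFace o X v) := by
  refine fun u v huv ↦ Set.disjoint_left.2 fun x hxu hxv ↦ ?_
  have hu := norm_eq_of_mem_sphere u
  have hv := norm_eq_of_mem_sphere v
  have hu₀ : (u : V) ≠ 0 := ne_zero_of_mem_unit_sphere u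
  have huv₁ := areaForm_nonpos_of_mem_openFace hxu hxv.1
  have huv₂ := areaForm_nonpos_of_mem_openFace hxv hxu.1
  rw [o.areaForm_swap, neg_nonpos] at huv₂
  obtain ⟨c, hc⟩ := exists_eq_smul_of_areaForm_eq_zero o hu₀ (le_antisymm huv₁ huv₂)
  have habs : |c| = 1 := by simpa [norm_smul, hu, hv] using (congrArg norm hc).symm
  rcases eq_or_eq_neg_of_abs_eq habs with rfl | rfl
  · exact huv (Subtype.ext (by rw [hc, one_smul]))
  · rw [neg_one_smul] at hc
    exact Set.disjoint_left.1 (disjoint_face_face_neg hX hu₀) hxu.1 (hc ▸ hxv.1)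

lemma injOn_areaForm_face (X : Set V) (hg : g ≠ 0) : (face X g).InjOn (ω g) := by
  refine fun x hx y hy hxy ↦ eq_of_inner_eq o (f := J g) (g := g) ?_ ?_ (inner_eq_of_mem_face hx hy)
  · rw [o.areaForm_rightAngleRotation_left, neg_ne_zero]
    exact inner_self_ne_zero.2 hg
  · rwa [o.inner_rightAngleRotation_left, o.inner_rightAngleRotation_left]

lemma ncard_openFace_add_one (hfin : X.Finite) (hne : X.Nonempty) (hg : g ≠ 0) :
    (openFace o X g).ncard + 1 = (face X g).ncard := by
  have hface := hfin.subset (face_subset X g)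
  obtain ⟨y, hy, hmax⟩ := exists_max_image _ (ω g) hface (face_nonempty hfin hne g)
  have hsdiff : openFace o X g = face X g \ {y} := by
    ext x
    constructor
    · rintro ⟨hx, z, hz, hxz⟩
      refine ⟨hx, ?_⟩
      rintro rfl
      exact (hmax z hz).not_gt hxz
    · rintro ⟨hx, hxy⟩
      exact ⟨hx, y, hy, (hmax x hx).lt_of_ne fun he ↦ hxy (injOn_areaForm_face o X hg hx hy he)⟩
  rw [hsdiff, ncard_sdiff_singleton_add_one hy hface]

lemma ncard_openFace_add_le (hA : A.Finite) (hB : B.Finite) (hA₀ : A.Nonempty) (hB₀ : B.Nonempty)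
    (hg : g ≠ 0) :
    (openFace o A g).ncard + (openFace o B g).ncard ≤ (openFace o (A + B) g).ncard := by
  have hinj (X : Set V) : (face X g).InjOn (inner ℝ (J g)) := by
    simpa only [InjOn, o.inner_rightAngleRotation_left] using injOn_areaForm_face o X hg
  have hle := ncard_add_ncard_le_of_injOn_inner (hA.subset (face_subset A g))
    (hB.subset (face_subset B g)) (face_nonempty hA hA₀ g) (face_nonempty hB hB₀ g)
    (hinj A) (hinj B)
  have hcA := ncard_openFace_add_one o hA hA₀ hg
  have hcB := ncard_openFace_add_one o hB hB₀ hg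
  have hcAB := ncard_openFace_add_one o (hA.add hB) (hA₀.add hB₀) hg
  rw [face_add] at hcAB
  omega

lemma sum_ncard_openFace_le (hX : affineSpan ℝ X = ⊤) (hfin : X.Finite)
    (G : Finset (Metric.sphere (0 : V) 1)) :
    ∑ u ∈ G, (openFace o X u).ncard ≤ (boundaryPoints X).ncard := by
  rw [← finsum_mem_coe_finset, ← G.finite_toSet.ncard_biUnion
    (fun u _ ↦ hfin.subset ((openFace_subset_face o X u).trans (face_subset X u)))
    fun u _ v _ huv ↦ pairwise_disjoint_openFace o hX huv]
  refine ncard_le_ncard (iUnion₂_subset fun u _ x hx ↦ ?_) (hfin.subset inter_subset_left)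
  exact (mem_boundaryPoints_iff hX).2 ⟨u, ne_zero_of_mem_unit_sphere u, hx.1⟩

lemma exists_ncard_boundaryPoints_le_sum (hX : affineSpan ℝ X = ⊤) (hfin : X.Finite) :
    ∃ G : Finset (Metric.sphere (0 : V) 1), ∀ H, G ⊆ H →
      (boundaryPoints X).ncard ≤ ∑ u ∈ H, (openFace o X u).ncard := by
  obtain ⟨G, hG, hsub⟩ := finite_subset_iUnion (hfin.subset inter_subset_left)
    (fun x hx ↦ mem_iUnion.2 (exists_mem_openFace o hX hfin hx))
  obtain ⟨G, rfl⟩ := hG.exists_finset_coe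
  refine ⟨G, fun H hGH ↦ le_trans (ncard_le_ncard ?_ ?_) (Finset.set_ncard_biUnion_le H _)⟩
  · exact hsub.trans (biUnion_mono hGH fun _ _ ↦ Subset.rfl)
  · exact hfin.subset (iUnion₂_subset fun u _ ↦
      (openFace_subset_face o X u).trans (face_subset X u))

lemma ncard_boundaryPoints_add_le (hA : affineSpan ℝ A = ⊤) (hB : affineSpan ℝ B = ⊤)
    (hAfin : A.Finite) (hBfin : B.Finite) :
    (boundaryPoints A).ncard + (boundaryPoints B).ncard ≤ (boundaryPoints (A + B)).ncard := by
  classical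
  let o := someOrientation V
  have hA₀ := nonempty_of_affineSpan_eq_top hA
  have hB₀ := nonempty_of_affineSpan_eq_top hB
  obtain ⟨G, hG⟩ := exists_ncard_boundaryPoints_le_sum o hA hAfin
  obtain ⟨H, hH⟩ := exists_ncard_boundaryPoints_le_sum o hB hBfin
  calc (boundaryPoints A).ncard + (boundaryPoints B).ncard
      ≤ ∑ u ∈ G ∪ H, (openFace o A u).ncard + ∑ u ∈ G ∪ H, (openFace o B u).ncard :=
        add_le_add (hG _ Finset.subset_union_left) (hH _ Finset.subset_union_right)
    _ = ∑ u ∈ G ∪ H, ((openFace o A u).ncard + (openFace o B u).ncard) :=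
        Finset.sum_add_distrib.symm
    _ ≤ ∑ u ∈ G ∪ H, (openFace o (A + B) u).ncard :=
        Finset.sum_le_sum fun u _ ↦
          ncard_openFace_add_le o hAfin hBfin hA₀ hB₀ (ne_zero_of_mem_unit_sphere u)
    _ ≤ (boundaryPoints (A + B)).ncard :=
        sum_ncard_openFace_le o (affineSpan_add_eq_top hA hB₀) (hAfin.add hBfin) _

/-! ### Sumsets of two sets with at least four points -/

lemma exists_separated_of_apex {a b c : V} (hx : x ∈ X) (ha : a ∈ X) (hb : b ∈ X) (hc : c ∈ X)
    (hab : ω (a - x) (b - x) ≠ 0) (hbc : ω (b - x) (c - x) ≠ 0) (hca : ω (c - x) (a - x) ≠ 0) :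
    ∃ p ∈ X, ∃ q ∈ X, ∃ s ∈ X, ∃ t ∈ X, ω (q - p) (s - p) * ω (q - p) (t - p) < 0 := by
  -- Otherwise the three areas would have pairwise opposite signs.
  by_contra! hcon
  have ha' := hcon x hx a ha b hb c hc
  have hb' := hcon x hx b hb c hc a ha
  have hc' := hcon x hx c hc a ha b hb
  rw [o.areaForm_swap (a - x) (c - x), mul_neg, neg_nonneg] at ha'
  rw [o.areaForm_swap (b - x) (a - x), mul_neg, neg_nonneg] at hb'
  rw [o.areaForm_swap (c - x) (b - x), mul_neg, neg_nonneg] at hc'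
  rcases lt_or_gt_of_ne hab with h₁ | h₁ <;> rcases lt_or_gt_of_ne hbc with h₂ | h₂ <;>
    rcases lt_or_gt_of_ne hca with h₃ | h₃ <;> nlinarith

lemma exists_separated_of_mem_line {a b c d : V} (ha : a ∈ X) (hb : b ∈ X) (hc : c ∈ X)
    (hd : d ∈ X) (hda : d ≠ a) (hdb : d ≠ b) (habc : ω (a - c) (b - c) ≠ 0)
    (habd : ω (a - d) (b - d) = 0) :
    ∃ p ∈ X, ∃ q ∈ X, ∃ s ∈ X, ∃ t ∈ X, ω (q - p) (s - p) * ω (q - p) (t - p) < 0 := by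
  obtain ⟨k, hk⟩ := exists_eq_smul_of_areaForm_eq_zero o (sub_ne_zero.2 hda.symm) habd
  have hk₀ : k ≠ 0 := by
    rintro rfl
    rw [zero_smul, sub_eq_zero] at hk
    exact hdb hk.symm
  have hac : a - c = (a - d) + (d - c) := by abel
  have hbc : b - c = k • (a - d) + (d - c) := by rw [← hk]; abel
  have harea : ω (a - c) (b - c) = (1 - k) * ω (a - d) (d - c) := by
    rw [hac, hbc]
    simp only [map_add, map_smul, LinearMap.add_apply, smul_eq_mul,
      o.areaForm_apply_self, o.areaForm_swap (d - c) (a - d)]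
    ring
  have hne : ω (a - d) (d - c) ≠ 0 := right_ne_zero_of_mul (harea ▸ habc)
  refine exists_separated_of_apex o hc ha hb hd habc ?_ ?_
  · rw [hbc, map_add, map_smul, LinearMap.add_apply, LinearMap.smul_apply, smul_eq_mul,
      o.areaForm_apply_self, add_zero]
    exact mul_ne_zero hk₀ hne
  · rw [hac, map_add, o.areaForm_apply_self, add_zero, o.areaForm_swap]
    exact neg_ne_zero.2 hne

lemma exists_areaForm_ne_zero (hX : affineSpan ℝ X = ⊤) :
    ∃ a ∈ X, ∃ b ∈ X, ∃ c ∈ X, ω (b - a) (c - a) ≠ 0 := by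
  have : Nontrivial V := Module.nontrivial_of_finrank_eq_succ (Fact.out : Module.finrank ℝ V = 2)
  obtain ⟨a, ha⟩ := nonempty_of_affineSpan_eq_top hX
  obtain ⟨w, hw⟩ := exists_ne (0 : V)
  obtain ⟨b, hb, hab⟩ := exists_inner_ne hX hw ⟪w, a⟫_ℝ
  have hba : b - a ≠ 0 := sub_ne_zero.2 fun h ↦ hab (by rw [h])
  obtain ⟨c, hc, hne⟩ :=
    exists_inner_ne hX ((map_ne_zero_iff _ (J).injective).2 hba) ⟪J (b - a), a⟫_ℝ
  refine ⟨a, ha, b, hb, c, hc, ?_⟩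
  rwa [← o.inner_rightAngleRotation_left, inner_sub_right, sub_ne_zero]

lemma exists_separated (hX : affineSpan ℝ X = ⊤) (hcard : 4 ≤ X.ncard) :
    ∃ p ∈ X, ∃ q ∈ X, ∃ s ∈ X, ∃ t ∈ X, ω (q - p) (s - p) * ω (q - p) (t - p) < 0 := by
  obtain ⟨c, hc, a, ha, b, hb, habc⟩ := exists_areaForm_ne_zero o hX
  obtain ⟨d, hd, hdabc⟩ : ∃ d ∈ X, d ∉ ({a, b, c} : Set V) := by
    refine exists_mem_notMem_of_ncard_lt_ncard (lt_of_le_of_lt ?_ hcard)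
    exact (ncard_insert_le _ _).trans
      (Nat.succ_le_succ ((ncard_insert_le _ _).trans (by rw [ncard_singleton])))
  simp only [mem_insert_iff, mem_singleton_iff, not_or] at hdabc
  obtain ⟨hda, hdb, hdc⟩ := hdabc
  have hrot (p q r : V) : ω (p - r) (q - r) = ω (q - p) (r - p) := by
    simp only [map_sub, LinearMap.sub_apply, o.areaForm_apply_self,
      o.areaForm_swap q p, o.areaForm_swap q r]
    ring
  by_cases h₁ : ω (a - d) (b - d) = 0
  · exact exists_separated_of_mem_line o ha hb hc hd hda hdb habc h₁
  by_cases h₂ : ω (b - d) (c - d) = 0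
  · exact exists_separated_of_mem_line o hb hc ha hd hdb hdc (hrot a b c ▸ habc) h₂
  by_cases h₃ : ω (c - d) (a - d) = 0
  · exact exists_separated_of_mem_line o hc ha hb hd hdc hda (hrot c a b ▸ habc) h₃
  exact exists_separated_of_apex o hd ha hb hc h₁ h₂ h₃

variable {o} in
lemma ne_zero_of_mem_chain (hx : x ∈ chain o X h) : h ≠ 0 := by
  obtain ⟨-, -, -, f, -, hf⟩ := hx
  rintro rfl
  simp at hf

lemma mem_chain_of_sub_eq_smul {c : ℝ} (hX : affineSpan ℝ X = ⊤) (hh : h ≠ 0)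
    (hx : x ∈ boundaryPoints X) (h₁ : x ∉ face X h) (h₂ : x ∉ face X (-h)) (hy : y ∈ X)
    (hxy : x - y = c • J h) (hc : 0 < c) : x ∈ chain o X h := by
  obtain ⟨f, hf₀, hf⟩ := (mem_boundaryPoints_iff hX).1 hx
  have hle := sub_nonneg.2 (hf.2 y hy)
  rw [← inner_sub_right, hxy, real_inner_smul_right, o.inner_rightAngleRotation_right,
    ← o.areaForm_swap] at hle
  exact ⟨hx.1, h₁, h₂, f, hf, (nonneg_of_mul_nonneg_right hle hc).lt_of_ne'
    fun h₀ ↦ hf₀ (eq_zero_of_mem_face o hh h₁ h₂ hf h₀)⟩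

lemma isOpen_setOf_mem_chain (X : Set V) (x : V) : IsOpen {h : V | x ∈ chain o X h} := by
  refine isOpen_iff_eventually.2 ?_
  rintro h ⟨hx, h₁, h₂, f, hf, hfpos⟩
  obtain ⟨s, hs, hxs⟩ : ∃ s ∈ X, ⟪h, x⟫_ℝ < ⟪h, s⟫_ℝ := by
    by_contra! hcon
    exact h₁ ⟨hx, hcon⟩
  obtain ⟨t, ht, htx⟩ : ∃ t ∈ X, ⟪h, t⟫_ℝ < ⟪h, x⟫_ℝ := by
    by_contra! hcon
    exact h₂ (mem_face_neg.2 ⟨hx, hcon⟩)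
  have hinner (z : V) : Continuous fun k : V ↦ ⟪k, z⟫_ℝ := by fun_prop
  have harea : Continuous fun k : V ↦ ω k f := by
    simp only [← o.inner_rightAngleRotation_left]
    exact (J).continuous.inner continuous_const
  filter_upwards [(hinner x).continuousAt.eventually_lt (hinner s).continuousAt hxs,
    (hinner t).continuousAt.eventually_lt (hinner x).continuousAt htx,
    harea.continuousAt.eventually_const_lt hfpos] with k hks hkt hkf
  exact ⟨hx, fun hk ↦ (hk.2 s hs).not_gt hks, fun hk ↦ ((mem_face_neg.1 hk).2 t ht).not_gt hkt,
    f, hf, hkf⟩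

lemma exists_chain_nonempty (hA : affineSpan ℝ A = ⊤) (hAb : A ⊆ boundaryPoints A)
    (hcard : 4 ≤ A.ncard) (hX : X.Countable) :
    ∃ h, X.InjOn (inner ℝ h) ∧ (chain o A h).Nonempty ∧ (chain (-o) A h).Nonempty := by
  have : CompleteSpace V := FiniteDimensional.complete ℝ V
  suffices ∃ h p q, p ∈ chain o A h ∧ q ∈ chain (-o) A h by
    obtain ⟨h, p, q, hp, hq⟩ := this
    obtain ⟨k, hk, hpk, hqk⟩ := (dense_setOf_injOn_inner hX).exists_mem_open
      ((isOpen_setOf_mem_chain o A p).inter (isOpen_setOf_mem_chain (-o) A q)) ⟨h, hp, hq⟩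
    exact ⟨k, hk, ⟨p, hpk⟩, ⟨q, hqk⟩⟩
  obtain ⟨p, hp, q, hq, s, hs, t, ht, hst⟩ := exists_separated o hA hcard
  have hqp : q - p ≠ 0 := by
    intro h₀
    simp [h₀] at hst
  set h := J (q - p) with hdef
  have hh : h ≠ 0 := (map_ne_zero_iff _ (J).injective).2 hqp
  have hJh : J h = p - q := by rw [hdef, o.rightAngleRotation_rightAngleRotation, neg_sub]
  have hlevel : ⟪h, q⟫_ℝ = ⟪h, p⟫_ℝ := by
    rw [← sub_eq_zero, ← inner_sub_right, hdef, o.inner_rightAngleRotation_self]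
  simp only [← o.inner_rightAngleRotation_left, ← hdef, inner_sub_right] at hst
  have hmid (z : V) (hz : ⟪h, z⟫_ℝ = ⟪h, p⟫_ℝ) : z ∉ face A h ∧ z ∉ face A (-h) := by
    refine ⟨fun hf ↦ ?_, fun hf ↦ ?_⟩
    · have hle := hf.2
      rw [hz] at hle
      nlinarith [hle s hs, hle t ht]
    · have hle := (mem_face_neg.1 hf).2
      rw [hz] at hle
      nlinarith [hle s hs, hle t ht]
  refine ⟨h, p, q, mem_chain_of_sub_eq_smul o hA hh (hAb hp) (hmid p rfl).1 (hmid p rfl).2 hq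
    (by rw [hJh, one_smul]) one_pos, ?_⟩
  refine mem_chain_of_sub_eq_smul (-o) hA hh (hAb hq) (hmid q hlevel).1 (hmid q hlevel).2 hp ?_
    one_pos
  rw [o.rightAngleRotation_neg_orientation, hJh, one_smul, neg_sub]

lemma chain_add_chain_neg_subset (hA : affineSpan ℝ A = ⊤) (hB : affineSpan ℝ B = ⊤)
    (hh : h ≠ 0) : chain o A h + chain (-o) B h ⊆ interiorPoints (A + B) := by
  rintro _ ⟨a, ha, b, hb, rfl⟩
  refine add_mem_interiorPoints hA ha.1 hb.1 fun w hw haw hbw ↦ ?_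
  exact (areaForm_pos_of_mem_chain hA hh ha haw hw).not_gt
    (areaForm_neg_of_mem_chain_neg hB hh hb hbw hw)

lemma ncard_chain_add_ncard_chain_neg_le (hA : affineSpan ℝ A = ⊤) (hB : affineSpan ℝ B = ⊤)
    (hAfin : A.Finite) (hBfin : B.Finite) (hA₀ : (chain o A h).Nonempty)
    (hB₀ : (chain (-o) B h).Nonempty) :
    (chain o A h).ncard + (chain (-o) B h).ncard ≤ (interiorPoints (A + B)).ncard + 1 := by
  have hh : h ≠ 0 := ne_zero_of_mem_chain hA₀.some_mem
  refine (ncard_add_ncard_le_of_injOn_inner (hAfin.subset (chain_subset o A h))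
    (hBfin.subset (chain_subset (-o) B h)) hA₀ hB₀ (injOn_inner_chain A hh)
    (injOn_inner_chain B hh)).trans ?_
  gcongr
  exacts [(hAfin.add hBfin).subset inter_subset_left, chain_add_chain_neg_subset o hA hB hh]

lemma ncard_boundaryPoints_of_injOn (hX : affineSpan ℝ X = ⊤) (hfin : X.Finite) (hh : h ≠ 0)
    (hinj : X.InjOn (inner ℝ h)) :
    (boundaryPoints X).ncard = (chain o X h).ncard + (chain (-o) X h).ncard + 2 := by
  have hne := nonempty_of_affineSpan_eq_top hX
  rw [ncard_boundaryPoints o hX hfin hh, ncard_face_eq_one hfin hne hinj,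
    ncard_face_eq_one hfin hne (injOn_inner_neg hinj)]
  ring

lemma ncard_add_ncard_le_of_four_le (hA : affineSpan ℝ A = ⊤) (hB : affineSpan ℝ B = ⊤)
    (hAfin : A.Finite) (hBfin : B.Finite) (hAb : A ⊆ boundaryPoints A)
    (hBb : B ⊆ boundaryPoints B) (hcard : 4 ≤ A.ncard) (hle : A.ncard ≤ B.ncard) :
    A.ncard + B.ncard ≤ 2 * (interiorPoints (A + B)).ncard + 6 := by
  let o := someOrientation V
  obtain ⟨h, hinj, hA₁, hA₂⟩ := exists_chain_nonempty o hA hAb hcard (hAfin.union hBfin).countable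
  have hh := ne_zero_of_mem_chain hA₁.some_mem
  have hcA := ncard_boundaryPoints_of_injOn o hA hAfin hh (hinj.mono subset_union_left)
  have hcB := ncard_boundaryPoints_of_injOn o hB hBfin hh (hinj.mono subset_union_right)
  rw [show boundaryPoints A = A from inter_subset_left.antisymm hAb] at hcA
  rw [show boundaryPoints B = B from inter_subset_left.antisymm hBb] at hcB
  have hA₁pos := (ncard_pos (hAfin.subset (chain_subset o A h))).2 hA₁
  have hA₂pos := (ncard_pos (hAfin.subset (chain_subset (-o) A h))).2 hA₂
  -- One of the two pairings of opposite chains contains at least half of the points of `A` and `B`.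
  rcases le_total ((chain (-o) A h).ncard + (chain o B h).ncard)
    ((chain o A h).ncard + (chain (-o) B h).ncard) with hc | hc
  · have hB₂ : (chain (-o) B h).Nonempty := nonempty_of_ncard_ne_zero (by omega)
    have := ncard_chain_add_ncard_chain_neg_le o hA hB hAfin hBfin hA₁ hB₂
    omega
  · have hB₁ : (chain o B h).Nonempty := nonempty_of_ncard_ne_zero (by omega)
    have := ncard_chain_add_ncard_chain_neg_le o hB hA hBfin hAfin hB₁ hA₂
    rw [add_comm B A] at this
    omega

/-! ### Sumsets with a triangle -/

lemma areaForm_rightAngleRotation_sub_left (x y f : V) :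
    ω (J (y - x)) f = ⟪f, x⟫_ℝ - ⟪f, y⟫_ℝ := by
  rw [o.areaForm_rightAngleRotation_left, real_inner_comm, inner_sub_right, neg_sub]

lemma vadd_chain_neg_subset (hA : affineSpan ℝ A = ⊤) (hB : affineSpan ℝ B = ⊤) (hx : x ∈ A)
    (hy : y ∈ A) (hxy : J (y - x) ≠ 0) :
    x +ᵥ chain (-o) B (J (y - x)) ⊆ interiorPoints (A + B) := by
  rintro _ ⟨b, hb, rfl⟩
  refine add_mem_interiorPoints hA hx hb.1 fun f hf hxf hbf ↦ ?_
  have hneg := areaForm_neg_of_mem_chain_neg hB hxy hb hbf hf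
  rw [areaForm_rightAngleRotation_sub_left, sub_neg] at hneg
  exact (hxf.2 y hy).not_gt hneg

lemma vadd_chain_subset (hA : affineSpan ℝ A = ⊤) (hB : affineSpan ℝ B = ⊤) (hx : x ∈ A)
    (hy : y ∈ A) (hxy : J (y - x) ≠ 0) :
    y +ᵥ chain o B (J (y - x)) ⊆ interiorPoints (A + B) := by
  rintro _ ⟨b, hb, rfl⟩
  refine add_mem_interiorPoints hA hy hb.1 fun f hf hyf hbf ↦ ?_
  have hpos := areaForm_pos_of_mem_chain hB hxy hb hbf hf
  rw [areaForm_rightAngleRotation_sub_left, sub_pos] at hpos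
  exact (hyf.2 x hx).not_gt hpos

variable {o} in
lemma eq_zero_of_mem_face_of_mem_face {a b : V} (hB : affineSpan ℝ B = ⊤) (hh : h ≠ 0)
    (ha : a ∉ face A h) (hb : b ∈ face B h) (haf : a ∈ face A f) (hbf : b ∈ face B f)
    (hhf : ω h f = 0) : f = 0 := by
  have hmem (w : V) : a + b ∈ face (A + B) w ↔ a ∈ face A w ∧ b ∈ face B w :=
    add_mem_face_add_iff haf.1 hb.1
  refine eq_zero_of_mem_face o hh (fun hab ↦ ha ((hmem h).1 hab).1) (fun hab ↦ ?_)
    ((hmem f).2 ⟨haf, hbf⟩) hhf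
  exact Set.disjoint_left.1 (disjoint_face_face_neg hB hh) hb ((hmem (-h)).1 hab).2

lemma vadd_openFace_neg_subset (hA : affineSpan ℝ A = ⊤) (hB : affineSpan ℝ B = ⊤) (hx : x ∈ A)
    (hy : y ∈ A) (hxy : J (y - x) ≠ 0) (hyA : y ∉ face A (-J (y - x))) :
    y +ᵥ openFace o B (-J (y - x)) ⊆ interiorPoints (A + B) := by
  rintro _ ⟨b, hb, rfl⟩
  refine add_mem_interiorPoints hA hy hb.1.1 fun f hf hyf hbf ↦ hf ?_
  refine eq_zero_of_mem_face_of_mem_face hB (neg_ne_zero.2 hxy) hyA hb.1 hyf hbf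
    ((areaForm_nonpos_of_mem_openFace hb hbf).antisymm ?_)
  rw [map_neg, LinearMap.neg_apply, areaForm_rightAngleRotation_sub_left, neg_sub, sub_nonneg]
  exact hyf.2 x hx

lemma vadd_openFace_inter_subset {z : V} (hA : affineSpan ℝ A = ⊤) (hB : affineSpan ℝ B = ⊤)
    (hh : h ≠ 0) (hz : z ∈ A) (hzA : z ∉ face A h) :
    z +ᵥ (openFace o B h ∩ openFace (-o) B h) ⊆ interiorPoints (A + B) := by
  rintro _ ⟨b, ⟨hb, hb'⟩, rfl⟩
  refine add_mem_interiorPoints hA hz hb.1.1 fun f hf hzf hbf ↦ hf ?_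
  refine eq_zero_of_mem_face_of_mem_face hB hh hzA hb.1 hzf hbf
    ((areaForm_nonpos_of_mem_openFace hb hbf).antisymm ?_)
  simpa only [o.areaForm_neg_orientation, LinearMap.neg_apply, neg_nonpos]
    using areaForm_nonpos_of_mem_openFace hb' hbf

lemma ncard_face_le_ncard_openFace_inter_add_two (hfin : X.Finite) (hne : X.Nonempty)
    (hh : h ≠ 0) : (face X h).ncard ≤ (openFace o X h ∩ openFace (-o) X h).ncard + 2 := by
  have hface := hfin.subset (face_subset X h)
  have h₁ := openFace_subset_face o X h
  have h₂ := openFace_subset_face (-o) X h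
  have hle := ncard_le_ncard (union_subset h₁ h₂) hface
  have hadd := ncard_union_add_ncard_inter _ _ (hface.subset h₁) (hface.subset h₂)
  have hcard₁ := ncard_openFace_add_one o hfin hne hh
  have hcard₂ := ncard_openFace_add_one (-o) hfin hne hh
  omega

lemma ncard_add_ncard_le_of_disjoint {α : Type*} {I S T : Set α} (hI : I.Finite) (hS : S ⊆ I)
    (hT : T ⊆ I) (hST : Disjoint S T) : S.ncard + T.ncard ≤ I.ncard := by
  rw [← ncard_union_eq hST (hI.subset hS) (hI.subset hT)]
  exact ncard_le_ncard (union_subset hS hT) hI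

lemma ncard_add_ncard_add_ncard_le_of_injOn {α β : Type*} {I S T U : Set α} {φ : α → β} {t u : β}
    (hI : I.Finite) (hS : S ⊆ I) (hT : T ⊆ I) (hU : U ⊆ I) (hinj : S.InjOn φ)
    (hSu : ∀ p ∈ S, φ p ≠ u) (hTt : ∀ p ∈ T, φ p = t) (hUu : ∀ p ∈ U, φ p = u) (htu : t ≠ u) :
    S.ncard + T.ncard + U.ncard ≤ I.ncard + 1 := by
  have hdisj : Disjoint (S ∪ T) U := by
    refine Set.disjoint_left.2 ?_
    rintro p (hp | hp) hpU
    · exact hSu p hp (hUu p hpU)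
    · exact htu ((hTt p hp).symm.trans (hUu p hpU))
  have hle := ncard_add_ncard_le_of_disjoint hI (union_subset hS hT) hU hdisj
  have hadd := ncard_union_add_ncard_inter S T (hI.subset hS) (hI.subset hT)
  have hinter : (S ∩ T).ncard ≤ 1 :=
    (ncard_le_one ((hI.subset hS).subset inter_subset_left)).2 fun p hp q hq ↦
      hinj hp.1 hq.1 ((hTt p hp.2).trans (hTt q hq.2).symm)
  omega

lemma inner_ne_of_mem_vadd_chain {b p v : V} (hb : b ∈ face X (-h)) (hp : p ∈ v +ᵥ chain o X h) :
    ⟪h, p⟫_ℝ ≠ ⟪h, v⟫_ℝ + ⟪h, b⟫_ℝ := by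
  obtain ⟨c, hc, rfl⟩ := hp
  simp only [vadd_eq_add, inner_add_right, ne_eq, add_right_inj]
  exact fun hcb ↦ hc.2.2.1 (mem_face_neg.2 ⟨hc.1, hcb ▸ (mem_face_neg.1 hb).2⟩)

lemma eq_of_ncard_le_of_levels {α β : Type*} {I L R T U : Set α} {φ : α → β} {t u : β}
    (hI : I.Finite) (hL : L ⊆ I) (hR : R ⊆ I) (hT : T ⊆ I) (hU : U ⊆ I) (hLinj : L.InjOn φ)
    (hRinj : R.InjOn φ) (hLu : ∀ p ∈ L, φ p ≠ u) (hRu : ∀ p ∈ R, φ p ≠ u)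
    (hTt : ∀ p ∈ T, φ p = t) (hUu : ∀ p ∈ U, φ p = u)
    (hcard : 2 * I.ncard + 1 ≤ L.ncard + R.ncard + T.ncard + U.ncard) :
    L = I ∧ R = I ∧ T.ncard = 1 ∧ U.ncard = 0 := by
  have hdisj {S W : Set α} (hS : ∀ p ∈ S, φ p ≠ u) (hW : ∀ p ∈ W, φ p = u) : Disjoint S W :=
    Set.disjoint_left.2 fun p hp hpW ↦ hS p hp (hW p hpW)
  have hLU := ncard_add_ncard_le_of_disjoint hI hL hU (hdisj hLu hUu)
  have hRU := ncard_add_ncard_le_of_disjoint hI hR hU (hdisj hRu hUu)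
  have htu : t ≠ u := by
    rintro rfl
    have hRT := ncard_add_ncard_le_of_disjoint hI hR hT (hdisj hRu hTt)
    omega
  have hLTU := ncard_add_ncard_add_ncard_le_of_injOn hI hL hT hU hLinj hLu hTt hUu htu
  have hRTU := ncard_add_ncard_add_ncard_le_of_injOn hI hR hT hU hRinj hRu hTt hUu htu
  exact ⟨eq_of_subset_of_ncard_le hL (by omega) hI, eq_of_subset_of_ncard_le hR (by omega) hI,
    by omega, by omega⟩

lemma vadd_chain_eq_of_ncard_le {I : Set V} {z : V} (hI : I.Finite) (hB : affineSpan ℝ B = ⊤)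
    (hBfin : B.Finite) (hh : h ≠ 0) (hxy : ⟪h, x⟫_ℝ = ⟪h, y⟫_ℝ) (hL : x +ᵥ chain (-o) B h ⊆ I)
    (hR : y +ᵥ chain o B h ⊆ I) (hT : z +ᵥ (openFace o B h ∩ openFace (-o) B h) ⊆ I)
    (hU : y +ᵥ openFace o B (-h) ⊆ I) (hcard : 2 * I.ncard + 4 ≤ (boundaryPoints B).ncard) :
    x +ᵥ chain (-o) B h = I ∧ y +ᵥ chain o B h = I ∧
      (openFace o B h ∩ openFace (-o) B h).ncard = 1 ∧ (openFace o B (-h)).ncard = 0 := by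
  have hB₀ := nonempty_of_affineSpan_eq_top hB
  obtain ⟨t, ht⟩ := face_nonempty hBfin hB₀ h
  obtain ⟨u, hu⟩ := face_nonempty hBfin hB₀ (-h)
  have hTt : ∀ p ∈ z +ᵥ (openFace o B h ∩ openFace (-o) B h),
      ⟪h, p⟫_ℝ = ⟪h, z⟫_ℝ + ⟪h, t⟫_ℝ := by
    rintro _ ⟨b, hb, rfl⟩
    simpa [inner_add_right] using inner_eq_of_mem_face hb.1.1 ht
  have hUu : ∀ p ∈ y +ᵥ openFace o B (-h), ⟪h, p⟫_ℝ = ⟪h, y⟫_ℝ + ⟪h, u⟫_ℝ := by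
    rintro _ ⟨b, hb, rfl⟩
    simpa [inner_add_right] using inner_eq_of_mem_face hb.1 hu
  have hface := ncard_face_le_ncard_openFace_inter_add_two o hBfin hB₀ hh
  have hface_neg := ncard_openFace_add_one o hBfin hB₀ (neg_ne_zero.2 hh)
  have hboundary := ncard_boundaryPoints o hB hBfin hh
  have hlevels := eq_of_ncard_le_of_levels hI hL hR hT hU
    (injOn_inner_vadd (injOn_inner_chain B hh) x) (injOn_inner_vadd (injOn_inner_chain B hh) y)
    (fun p hp ↦ hxy ▸ inner_ne_of_mem_vadd_chain (-o) hu hp)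
    (fun p hp ↦ inner_ne_of_mem_vadd_chain o hu hp) hTt hUu
  simp only [ncard_vadd_set] at hlevels
  exact hlevels (by omega)

/-- The shape forced on `B` along the side `x y` of a triangle `x y z` when `I`, the set of interior
points of the sumset of the triangle and `B`, has as few as `(|B| - 4) / 2` points. -/
structure TightSide (I B : Set V) (x y z : V) : Prop where
  ncard_face : (face B (J (y - x))).ncard = 3
  ncard_face_neg : (face B (-J (y - x))).ncard = 1
  vadd_chain_neg : x +ᵥ chain (-o) B (J (y - x)) = I
  vadd_chain : y +ᵥ chain o B (J (y - x)) = I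
  exists_sub_mem_face : ∃ p ∈ I, p - z ∈ face B (J (y - x))

lemma tightSide_of_ncard_le {z : V} (hA : affineSpan ℝ A = ⊤) (hB : affineSpan ℝ B = ⊤)
    (hAfin : A.Finite) (hBfin : B.Finite) (hBb : B ⊆ boundaryPoints B) (hx : x ∈ A) (hy : y ∈ A)
    (hz : z ∈ A) (hxyz : ω (y - x) (z - x) < 0)
    (hfew : 2 * (interiorPoints (A + B)).ncard + 4 ≤ B.ncard) :
    TightSide o (interiorPoints (A + B)) B x y z ∧
      B.ncard = 2 * (interiorPoints (A + B)).ncard + 4 := by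
  have hB₀ := nonempty_of_affineSpan_eq_top hB
  set h := J (y - x) with hdef
  have hyx : ⟪h, x⟫_ℝ = ⟪h, y⟫_ℝ := by
    rw [eq_comm, ← sub_eq_zero, ← inner_sub_right, hdef, o.inner_rightAngleRotation_self]
  have hzy : ⟪h, z⟫_ℝ < ⟪h, y⟫_ℝ := by
    rwa [← o.inner_rightAngleRotation_left, ← hdef, inner_sub_right, hyx, sub_neg] at hxyz
  have hh : h ≠ 0 := by
    rintro h₀
    simp [h₀] at hzy
  set I := interiorPoints (A + B)
  have hI : I.Finite := (hAfin.add hBfin).subset inter_subset_left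
  have hL : x +ᵥ chain (-o) B h ⊆ I := vadd_chain_neg_subset o hA hB hx hy hh
  have hR : y +ᵥ chain o B h ⊆ I := vadd_chain_subset o hA hB hx hy hh
  have hU : y +ᵥ openFace o B (-h) ⊆ I := vadd_openFace_neg_subset o hA hB hx hy hh
    fun hf ↦ ((mem_face_neg.1 hf).2 z hz).not_gt hzy
  have hT : z +ᵥ (openFace o B h ∩ openFace (-o) B h) ⊆ I :=
    vadd_openFace_inter_subset o hA hB hh hz fun hf ↦ (hf.2 y hy).not_gt hzy
  have hcard : (boundaryPoints B).ncard = B.ncard := by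
    rw [show boundaryPoints B = B from inter_subset_left.antisymm hBb]
  obtain ⟨hLI, hRI, hT₁, hU₀⟩ :=
    vadd_chain_eq_of_ncard_le o hI hB hBfin hh hyx hL hR hT hU (hcard ▸ hfew)
  have hface := ncard_face_le_ncard_openFace_inter_add_two o hBfin hB₀ hh
  have hface_neg := ncard_openFace_add_one o hBfin hB₀ (neg_ne_zero.2 hh)
  have hboundary := ncard_boundaryPoints o hB hBfin hh
  have hL₁ := congrArg ncard hLI
  have hR₁ := congrArg ncard hRI
  rw [ncard_vadd_set] at hL₁ hR₁
  have hface₃ : (face B h).ncard = 3 := by omega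
  have hface₁ : (face B (-h)).ncard = 1 := by omega
  refine ⟨⟨hface₃, hface₁, hLI, hRI, ?_⟩, by omega⟩
  obtain ⟨b, hb⟩ := nonempty_of_ncard_ne_zero (hT₁.trans_ne one_ne_zero)
  exact ⟨z +ᵥ b, hT ⟨b, hb, rfl⟩, by rw [vadd_eq_add, add_sub_cancel_left]; exact hb.1.1⟩

namespace TightSide

variable {o} {I : Set V} {p z b : V}

lemma sub_mem_chain_neg (hxy : TightSide o I B x y z) (hp : p ∈ I) :
    p - x ∈ chain (-o) B (J (y - x)) := by
  rw [← hxy.vadd_chain_neg] at hp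
  obtain ⟨b, hb, rfl⟩ := hp
  simpa only [vadd_eq_add, add_sub_cancel_left] using hb

lemma sub_mem_chain (hxy : TightSide o I B x y z) (hp : p ∈ I) :
    p - y ∈ chain o B (J (y - x)) := by
  rw [← hxy.vadd_chain] at hp
  obtain ⟨b, hb, rfl⟩ := hp
  simpa only [vadd_eq_add, add_sub_cancel_left] using hb

lemma mem_face_or (hxy : TightSide o I B x y z) (hB : affineSpan ℝ B = ⊤)
    (hh : J (y - x) ≠ 0) (hb : b ∈ boundaryPoints B) :
    b ∈ face B (J (y - x)) ∨ b ∈ face B (-J (y - x)) ∨ x + b ∈ I ∨ y + b ∈ I := by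
  rw [boundaryPoints_eq_union (o := o) hB hh] at hb
  rcases hb with ((hb | hb) | hb) | hb
  · exact .inl hb
  · exact .inr (.inl hb)
  · exact .inr (.inr (.inr (hxy.vadd_chain ▸ vadd_mem_vadd_set hb)))
  · exact .inr (.inr (.inl (hxy.vadd_chain_neg ▸ vadd_mem_vadd_set hb)))

end TightSide

/-- A clockwise triangle `x y z` all of whose sides are tight for `B`. -/
structure TightTriangle (I B : Set V) (x y z : V) : Prop where
  areaForm_neg : ω (y - x) (z - x) < 0
  side₁ : TightSide o I B x y z
  side₂ : TightSide o I B y z x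
  side₃ : TightSide o I B z x y

lemma areaForm_sub_rotate (x y z : V) : ω (z - y) (x - y) = ω (y - x) (z - x) := by
  simp only [map_sub, LinearMap.sub_apply, o.areaForm_apply_self, o.areaForm_swap y x,
    o.areaForm_swap z x, o.areaForm_swap z y]
  ring

namespace TightTriangle

variable {o} {I : Set V} {p z b : V}

lemma rotate (hT : TightTriangle o I B x y z) : TightTriangle o I B y z x :=
  ⟨(areaForm_sub_rotate o x y z).trans_lt hT.areaForm_neg, hT.side₂, hT.side₃, hT.side₁⟩

lemma rightAngleRotation_ne_zero (hT : TightTriangle o I B x y z) : J (y - x) ≠ 0 := by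
  intro h₀
  have hneg := hT.areaForm_neg
  rw [← o.inner_rightAngleRotation_left, h₀, inner_zero_left] at hneg
  exact hneg.false

lemma sub_mem_face (hT : TightTriangle o I B x y z) (hB : affineSpan ℝ B = ⊤)
    (hBb : B ⊆ boundaryPoints B) (hp : p ∈ I) : p - z ∈ face B (J (y - x)) := by
  have hpz : p - z ∈ B := chain_subset o B _ (hT.side₂.sub_mem_chain hp)
  rcases hT.side₁.mem_face_or hB hT.rightAngleRotation_ne_zero (hBb hpz) with h | h | h | h
  · exact h
  · have hle := (mem_face_neg.1 h).2 _ (chain_subset _ B _ (hT.side₁.sub_mem_chain_neg hp))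
    have hneg := hT.areaForm_neg
    rw [← o.inner_rightAngleRotation_left, inner_sub_right] at hneg
    rw [inner_sub_right, inner_sub_right] at hle
    linarith
  · have hchain := hT.side₃.sub_mem_chain h
    rw [add_sub_cancel_left] at hchain
    exact (Set.disjoint_left.1 (disjoint_chain_chain_neg hB
      hT.rotate.rotate.rightAngleRotation_ne_zero) hchain (hT.side₃.sub_mem_chain_neg hp)).elim
  · have hchain := hT.side₂.sub_mem_chain_neg h
    rw [add_sub_cancel_left] at hchain
    exact (Set.disjoint_left.1 (disjoint_chain_chain_neg hB
      hT.rotate.rightAngleRotation_ne_zero) (hT.side₂.sub_mem_chain hp) hchain).elim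

lemma subsingleton (hT : TightTriangle o I B x y z) (hB : affineSpan ℝ B = ⊤)
    (hBb : B ⊆ boundaryPoints B) : I.Subsingleton := by
  intro p hp q hq
  have hlevel := inner_eq_of_mem_face (hT.sub_mem_face hB hBb hp) (hT.sub_mem_face hB hBb hq)
  refine sub_left_injective (b := x) (injOn_inner_chain (o := -o) B hT.rightAngleRotation_ne_zero
    (hT.side₁.sub_mem_chain_neg hp) (hT.side₁.sub_mem_chain_neg hq) ?_)
  rw [inner_sub_right, inner_sub_right, sub_left_inj] at hlevel ⊢
  exact hlevel

lemma eq_of_mem_face_of_mem_face (hT : TightTriangle o I B x y z) (hB : affineSpan ℝ B = ⊤)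
    (hBb : B ⊆ boundaryPoints B) (hp : p ∈ I) (h₁ : b ∈ face B (J (y - x)))
    (h₂ : b ∈ face B (J (z - y))) : b = (p - x - y - z) + (y + y) := by
  refine eq_of_inner_eq o (f := J (y - x)) (g := J (z - y)) ?_ ?_ ?_
  · rw [o.areaForm_comp_rightAngleRotation, ← sub_add_sub_cancel z x y, map_add]
    have hneg := hT.areaForm_neg
    rw [← neg_sub y x, map_neg, o.areaForm_apply_self, neg_zero, add_zero]
    exact hneg.ne
  · have hcorner : (p - x - y - z) + (y + y) = (p - z) + (y - x) := by abel
    rw [inner_eq_of_mem_face h₁ (hT.sub_mem_face hB hBb hp), hcorner, inner_add_right,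
      o.inner_rightAngleRotation_self, add_zero]
  · have hcorner : (p - x - y - z) + (y + y) = (p - x) - (z - y) := by abel
    rw [inner_eq_of_mem_face h₂ (hT.rotate.sub_mem_face hB hBb hp), hcorner,
      inner_sub_right _ (p - x), o.inner_rightAngleRotation_self, sub_zero]

lemma notMem_face_neg (hT : TightTriangle o I B x y z) (h₁ : b ∈ face B (-J (y - x))) :
    b ∉ face B (-J (z - y)) := by
  intro h₂
  have hsum : J (x - z) = -J (y - x) + -J (z - y) := by
    rw [← neg_add, ← map_add, ← map_neg]
    congr 1
    abel
  have hsub : face B (J (x - z)) ⊆ face B (-J (y - x)) := by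
    intro p hp
    have h₀ := hp.2 b h₁.1
    rw [hsum, inner_add_left, inner_add_left] at h₀
    exact ⟨hp.1, fun q hq ↦ (h₁.2 q hq).trans (by linarith [h₂.2 p hp.1])⟩
  have hle := ncard_le_ncard hsub (finite_of_ncard_ne_zero (by rw [hT.side₁.ncard_face_neg]; simp))
  rw [hT.side₁.ncard_face_neg, hT.side₃.ncard_face] at hle
  omega

lemma subset_vadd_add (hT : TightTriangle o {p} B x y z) (hB : affineSpan ℝ B = ⊤)
    (hBb : B ⊆ boundaryPoints B) :
    B ⊆ (p - x - y - z) +ᵥ (({x, y, z} : Set V) + {x, y, z}) := by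
  intro b hb
  have hmem {u v : V} (hu : u ∈ ({x, y, z} : Set V)) (hv : v ∈ ({x, y, z} : Set V))
      (h : b = (p - x - y - z) + (u + v)) :
      b ∈ (p - x - y - z) +ᵥ (({x, y, z} : Set V) + {x, y, z}) :=
    h ▸ vadd_mem_vadd_set (add_mem_add hu hv)
  by_cases hbx : x + b = p
  · exact hmem (u := y) (v := z) (by simp) (by simp) (by rw [← hbx]; abel)
  by_cases hby : y + b = p
  · exact hmem (u := x) (v := z) (by simp) (by simp) (by rw [← hby]; abel)
  by_cases hbz : z + b = p
  · exact hmem (u := x) (v := y) (by simp) (by simp) (by rw [← hbz]; abel)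
  have hp : p ∈ ({p} : Set V) := mem_singleton p
  have h₁ := hT.side₁.mem_face_or hB hT.rightAngleRotation_ne_zero (hBb hb)
  have h₂ := hT.side₂.mem_face_or hB hT.rotate.rightAngleRotation_ne_zero (hBb hb)
  have h₃ := hT.side₃.mem_face_or hB hT.rotate.rotate.rightAngleRotation_ne_zero (hBb hb)
  simp only [mem_singleton_iff, hbx, hby, hbz, or_false] at h₁ h₂ h₃
  -- The point `b` lies on two of the three long faces, since it is on at most one opposite face.
  have h₁₂ := hT.notMem_face_neg (b := b)
  have h₂₃ := hT.rotate.notMem_face_neg (b := b)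
  have h₃₁ := hT.rotate.rotate.notMem_face_neg (b := b)
  obtain ⟨hf, hg⟩ | ⟨hg, hk⟩ | ⟨hk, hf⟩ : b ∈ face B (J (y - x)) ∧ b ∈ face B (J (z - y)) ∨
      b ∈ face B (J (z - y)) ∧ b ∈ face B (J (x - z)) ∨
      b ∈ face B (J (x - z)) ∧ b ∈ face B (J (y - x)) := by tauto
  · exact hmem (by simp) (by simp) (hT.eq_of_mem_face_of_mem_face hB hBb hp hf hg)
  · exact hmem (u := z) (v := z) (by simp) (by simp)
      ((hT.rotate.eq_of_mem_face_of_mem_face hB hBb hp hg hk).trans (by abel))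
  · exact hmem (u := x) (v := x) (by simp) (by simp)
      ((hT.rotate.rotate.eq_of_mem_face_of_mem_face hB hBb hp hk hf).trans (by abel))

end TightTriangle

lemma ncard_triple_of_areaForm_ne_zero {z : V} (hxyz : ω (y - x) (z - x) ≠ 0) :
    ({x, y, z} : Set V).ncard = 3 := by
  have hxy : x ≠ y := by rintro rfl; simp at hxyz
  have hxz : x ≠ z := by rintro rfl; simp at hxyz
  have hyz : y ≠ z := by rintro rfl; exact hxyz (o.areaForm_apply_self _)
  exact ncard_eq_three.2 ⟨x, y, z, hxy, hxz, hyz, rfl⟩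

lemma isExceptionalPair_of_areaForm_neg {z : V} (hA : affineSpan ℝ ({x, y, z} : Set V) = ⊤)
    (hB : affineSpan ℝ B = ⊤) (hBfin : B.Finite) (hBb : B ⊆ boundaryPoints B)
    (hxyz : ω (y - x) (z - x) < 0)
    (hfew : 2 * (interiorPoints ({x, y, z} + B)).ncard + 4 ≤ B.ncard) :
    IsExceptionalPair {x, y, z} B := by
  set A : Set V := {x, y, z} with hAdef
  have hAfin : A.Finite := toFinite _
  have hx : x ∈ A := by simp [hAdef]
  have hy : y ∈ A := by simp [hAdef]
  have hz : z ∈ A := by simp [hAdef]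
  have hyzx := (areaForm_sub_rotate o x y z).trans_lt hxyz
  have hzxy := (areaForm_sub_rotate o y z x).trans_lt hyzx
  obtain ⟨h₁, hBcard⟩ := tightSide_of_ncard_le o hA hB hAfin hBfin hBb hx hy hz hxyz hfew
  have hT : TightTriangle o (interiorPoints (A + B)) B x y z := ⟨hxyz, h₁,
    (tightSide_of_ncard_le o hA hB hAfin hBfin hBb hy hz hx hyzx hfew).1,
    (tightSide_of_ncard_le o hA hB hAfin hBfin hBb hz hx hy hzxy hfew).1⟩
  obtain ⟨p, hp, -⟩ := h₁.exists_sub_mem_face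
  have hI : interiorPoints (A + B) = {p} := (hT.subsingleton hB hBb).eq_singleton_of_mem hp
  rw [hI, ncard_singleton] at hBcard
  refine ⟨ncard_triple_of_areaForm_ne_zero o hxyz.ne, ⟨p - x - y - z, ?_⟩, hBcard,
    by rw [hI, ncard_singleton]⟩
  refine eq_of_subset_of_ncard_le ((hI ▸ hT).subset_vadd_add hB hBb) ?_ (hAfin.add hAfin).vadd_set
  rw [ncard_vadd_set, hBcard]
  exact ncard_triple_add_self_le x y z

lemma isExceptionalPair_of_ncard_eq_three (hA : affineSpan ℝ A = ⊤) (hB : affineSpan ℝ B = ⊤)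
    (hBfin : B.Finite) (hBb : B ⊆ boundaryPoints B) (hcard : A.ncard = 3)
    (hfew : 2 * (interiorPoints (A + B)).ncard + 4 ≤ B.ncard) :
    IsExceptionalPair A B := by
  let o := someOrientation V
  obtain ⟨x, hx, y, hy, z, hz, hxyz⟩ := exists_areaForm_ne_zero o hA
  have hA₃ : A = {x, y, z} := by
    refine (eq_of_subset_of_ncard_le ?_ ?_ (finite_of_ncard_ne_zero (by omega))).symm
    · simp [insert_subset_iff, hx, hy, hz]
    · rw [hcard, ncard_triple_of_areaForm_ne_zero o hxyz]
  subst hA₃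
  rcases lt_or_gt_of_ne hxyz with h | h
  · exact isExceptionalPair_of_areaForm_neg o hA hB hBfin hBb h hfew
  · refine isExceptionalPair_of_areaForm_neg (-o) hA hB hBfin hBb ?_ hfew
    rwa [o.areaForm_neg_orientation, LinearMap.neg_apply, LinearMap.neg_apply, neg_lt_zero]

/-! ### The number of triangles of a triangulation -/

lemma mem_enterSet_rightAngleRotation (hX : affineSpan ℝ X = ⊤) (hx : x ∈ X)
    (hface : ∀ w, w ≠ 0 → x ∈ face X w → ω h w < 0) : x ∈ enterSet X (J h) := by
  obtain ⟨ε, hε, hmem⟩ := exists_add_smul_mem_interior_convexHull hX hx (d := J h)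
    fun w hw hf ↦ by
      rw [o.inner_rightAngleRotation_right, ← o.areaForm_swap]
      exact hface w hw hf
  exact ⟨hx, ε, hε, interior_subset hmem⟩

lemma areaForm_nonpos_of_mem_face_of_mem_enterSet (hf : x ∈ face X f)
    (hx : x ∈ enterSet X (J h)) : ω h f ≤ 0 := by
  obtain ⟨-, ε, hε, hmem⟩ := hx
  have hle := inner_le_of_mem_convexHull hf.2 hmem
  rw [inner_add_right, real_inner_smul_right, add_le_iff_nonpos_right,
    o.inner_rightAngleRotation_right, ← o.areaForm_swap] at hle
  exact nonpos_of_mul_nonpos_right hle hε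

lemma enterSet_rightAngleRotation (hX : affineSpan ℝ X = ⊤) (hh : h ≠ 0)
    (hinj : X.InjOn (inner ℝ h)) : enterSet X (J h) = interiorPoints X ∪ chain (-o) X h := by
  have hJh : J h ≠ 0 := by simpa using hh
  have hhJ : ⟪h, J h⟫_ℝ = 0 := by simp [o.inner_rightAngleRotation_right]
  ext x
  constructor
  · intro hx
    by_cases hint : x ∈ interior (convexHull ℝ X)
    · exact Or.inl ⟨hx.1, hint⟩
    obtain ⟨f, hf₀, hf⟩ := exists_mem_face_of_notMem_interior hX hx.1 hint
    have hhigh := notMem_face_of_mem_enterSet hinj hJh hhJ hx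
    have hlow := notMem_face_of_mem_enterSet (injOn_inner_neg hinj) hJh (by simp [hhJ]) hx
    have hneg : ω h f < 0 := (areaForm_nonpos_of_mem_face_of_mem_enterSet o hf hx).lt_of_ne
      fun h₀ ↦ hf₀ (eq_zero_of_mem_face o hh hhigh hlow hf h₀)
    exact Or.inr ⟨hx.1, hhigh, hlow, f, hf, by simpa [o.areaForm_neg_orientation] using hneg⟩
  · rintro (hx | hx)
    · exact mem_enterSet_rightAngleRotation o hX hx.1
        fun w hw hf ↦ absurd hf ((mem_interiorPoints_iff hX hx.1).1 hx w hw)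
    · exact mem_enterSet_rightAngleRotation o hX hx.1
        fun w hw hf ↦ areaForm_neg_of_mem_chain_neg hX hh hx hf hw

lemma ncard_enterSet_rightAngleRotation (hX : affineSpan ℝ X = ⊤) (hfin : X.Finite) (hh : h ≠ 0)
    (hinj : X.InjOn (inner ℝ h)) :
    (enterSet X (J h)).ncard = (interiorPoints X).ncard + (chain (-o) X h).ncard := by
  have hdisj : Disjoint (interiorPoints X) (chain (-o) X h) := by
    refine Set.disjoint_left.2 fun x hint hx ↦ ?_
    obtain ⟨-, -, -, f, hf, hfpos⟩ := hx
    exact (mem_interiorPoints_iff hX hint.1).1 hint f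
      (ne_zero_of_areaForm_ne_zero (-o) hfpos.ne') hf
  rw [enterSet_rightAngleRotation o hX hh hinj, ncard_union_eq hdisj
    (hfin.subset inter_subset_left) (hfin.subset (chain_subset (-o) X h))]

lemma ncard_enterSet_add_ncard_enterSet_neg_add_two (hX : affineSpan ℝ X = ⊤) (hfin : X.Finite)
    (hh : h ≠ 0) (hinj : X.InjOn (inner ℝ h)) :
    (enterSet X (J h)).ncard + (enterSet X (-J h)).ncard + 2 =
      2 * (interiorPoints X).ncard + (boundaryPoints X).ncard := by
  have hneg : -J h = (-o).rightAngleRotation h := by simp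
  rw [hneg, ncard_enterSet_rightAngleRotation o hX hfin hh hinj,
    ncard_enterSet_rightAngleRotation (-o) hX hfin hh hinj, neg_neg o,
    ncard_boundaryPoints_of_injOn o hX hfin hh hinj]
  ring

section SimplicialComplex

variable {K : Geometry.SimplicialComplex ℝ V} {d : V}

lemma card_le_three_of_mem_faces {s : Finset V} (hs : s ∈ K.faces) : s.card ≤ 3 := by
  have hcard := (K.indep hs).card_le_finrank_succ
  have hle := Submodule.finrank_le (vectorSpan ℝ (range ((↑) : s → V)))
  have hV : Module.finrank ℝ V = 2 := Fact.out
  rw [Fintype.card_coe] at hcard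
  omega

lemma card_eq_three_of_mem_enterSet (hinj : K.vertices.InjOn (inner ℝ h)) (hd : d ≠ 0)
    (hhd : ⟪h, d⟫_ℝ = 0) {s : Finset V} (hs : s ∈ K.faces) (hx : x ∈ enterSet (s : Set V) d) :
    s.card = 3 := by
  have hlt := two_lt_ncard_of_mem_enterSet s.finite_toSet (hinj.mono (coe_subset_vertices hs))
    hd hhd hx
  rw [ncard_coe_finset] at hlt
  exact le_antisymm (card_le_three_of_mem_faces hs) hlt

lemma eq_of_mem_enterSet_of_mem_enterSet (hinj : K.vertices.InjOn (inner ℝ h)) (hd : d ≠ 0)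
    (hhd : ⟪h, d⟫_ℝ = 0) {s t : Finset V} (hs : s ∈ K.faces) (ht : t ∈ K.faces)
    (hxs : x ∈ enterSet (s : Set V) d) (hxt : x ∈ enterSet (t : Set V) d) : s = t := by
  classical
  have hx := enterSet_inter_enterSet_subset hs ht d ⟨hxs, hxt⟩
  have hlt := two_lt_ncard_of_mem_enterSet (s.finite_toSet.inter_of_left _)
    (hinj.mono (inter_subset_left.trans (coe_subset_vertices hs))) hd hhd hx
  rw [← Finset.coe_inter, ncard_coe_finset] at hlt
  have hs_eq := Finset.eq_of_subset_of_card_le (Finset.inter_subset_left (s₁ := s) (s₂ := t))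
    ((card_le_three_of_mem_faces hs).trans hlt)
  have ht_eq := Finset.eq_of_subset_of_card_le (Finset.inter_subset_right (s₁ := s) (s₂ := t))
    ((card_le_three_of_mem_faces ht).trans hlt)
  exact hs_eq.symm.trans ht_eq

lemma ncard_enterSet_vertices (hfin : K.vertices.Finite) (hK : K.space = convexHull ℝ K.vertices)
    (hinj : K.vertices.InjOn (inner ℝ h)) (hd : d ≠ 0) (hhd : ⟪h, d⟫_ℝ = 0) {T : Finset (Finset V)}
    (hT : ∀ s, s ∈ T ↔ s ∈ K.faces ∧ s.card = 3) :
    (enterSet K.vertices d).ncard = ∑ s ∈ T, (enterSet (s : Set V) d).ncard := by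
  have hunion : enterSet K.vertices d = ⋃ s ∈ (T : Set (Finset V)), enterSet (s : Set V) d := by
    refine Subset.antisymm (fun x hx ↦ ?_) (iUnion₂_subset fun s hs ↦
      enterSet_mono (coe_subset_vertices ((hT s).1 hs).1) d)
    obtain ⟨s, hs, hxs⟩ := exists_mem_enterSet_of_mem_enterSet_vertices hfin hK hx
    exact mem_biUnion ((hT s).2 ⟨hs, card_eq_three_of_mem_enterSet hinj hd hhd hs hxs⟩) hxs
  rw [hunion, T.finite_toSet.ncard_biUnion
    (fun s _ ↦ s.finite_toSet.subset (enterSet_subset _ d)) fun s hs t ht hst ↦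
      Set.disjoint_left.2 fun x hxs hxt ↦ hst (eq_of_mem_enterSet_of_mem_enterSet hinj hd hhd
        ((hT s).1 hs).1 ((hT t).1 ht).1 hxs hxt), finsum_mem_coe_finset]

lemma ncard_enterSet_triangle_add_ncard_enterSet_triangle_neg (hinj : K.vertices.InjOn (inner ℝ h))
    (hh : h ≠ 0) {t : Finset V} (ht : t ∈ K.faces) (hcard : t.card = 3) :
    (enterSet (t : Set V) (J h)).ncard + (enterSet (t : Set V) (-J h)).ncard = 1 := by
  have hspan : affineSpan ℝ (range ((↑) : t → V)) = ⊤ := by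
    rw [(K.indep ht).affineSpan_eq_top_iff_card_eq_finrank_add_one, Fintype.card_coe, hcard,
      (Fact.out : Module.finrank ℝ V = 2)]
  have : Nontrivial t := Fintype.one_lt_card_iff_nontrivial.1 (by rw [Fintype.card_coe]; omega)
  have hrange : range ((↑) : t → V) = t := Subtype.range_coe
  have hint : interiorPoints (range ((↑) : t → V)) = ∅ :=
    interiorPoints_range_affineBasis ⟨_, K.indep ht, hspan⟩
  rw [hrange] at hspan hint
  have hcount := ncard_enterSet_add_ncard_enterSet_neg_add_two o hspan t.finite_toSet hh
    (hinj.mono (coe_subset_vertices ht))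
  have hsum := ncard_boundaryPoints_add_ncard_interiorPoints t.finite_toSet
  rw [hint, ncard_empty] at hcount hsum
  rw [ncard_coe_finset] at hsum
  omega

lemma exists_ne_zero_injOn_inner (hX : X.Countable) : ∃ h, h ≠ 0 ∧ X.InjOn (inner ℝ h) := by
  have : CompleteSpace V := FiniteDimensional.complete ℝ V
  have : Nontrivial V := Module.nontrivial_of_finrank_eq_succ (Fact.out : Module.finrank ℝ V = 2)
  obtain ⟨h, hinj, hh⟩ := (dense_setOf_injOn_inner hX).exists_mem_open isOpen_ne (exists_ne 0)
  exact ⟨h, hh, hinj⟩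

theorem ncard_triangles_add_two (hfin : K.vertices.Finite) (hK : K.space = convexHull ℝ K.vertices)
    (hX : affineSpan ℝ K.vertices = ⊤) :
    {s | s ∈ K.faces ∧ s.card = 3}.ncard + 2 =
      2 * (interiorPoints K.vertices).ncard + (boundaryPoints K.vertices).ncard := by
  let o := someOrientation V
  obtain ⟨h, hh, hinj⟩ := exists_ne_zero_injOn_inner hfin.countable
  obtain ⟨T, hT⟩ := ((finite_faces hfin).subset (sep_subset K.faces (·.card = 3))).exists_finset_coe
  have hmem (s : Finset V) : s ∈ T ↔ s ∈ K.faces ∧ s.card = 3 := by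
    rw [← Finset.mem_coe, hT, mem_ofPred_eq]
  have hJh : o.rightAngleRotation h ≠ 0 := by simpa using hh
  have hhJ : ⟪h, o.rightAngleRotation h⟫_ℝ = 0 := by
    simp [o.inner_rightAngleRotation_right]
  rw [← ncard_enterSet_add_ncard_enterSet_neg_add_two o hX hfin hh hinj,
    ncard_enterSet_vertices hfin hK hinj hJh hhJ hmem,
    ncard_enterSet_vertices hfin hK hinj (neg_ne_zero.2 hJh) (by simp [hhJ]) hmem,
    ← Finset.sum_add_distrib, Finset.sum_congr rfl fun t ht ↦
      ncard_enterSet_triangle_add_ncard_enterSet_triangle_neg o hinj hh ((hmem t).1 ht).1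
        ((hmem t).1 ht).2, Finset.sum_const, smul_eq_mul, mul_one, ← hT, ncard_coe_finset]

end SimplicialComplex

/-! ### The inequality between square roots -/

lemma affineSpan_eq_top_of_not_collinear (hX : ¬ Collinear ℝ X) : affineSpan ℝ X = ⊤ := by
  have hne : X.Nonempty := nonempty_iff_ne_empty.2 fun h ↦ hX (h ▸ collinear_empty ℝ V)
  rw [AffineSubspace.affineSpan_eq_top_iff_vectorSpan_eq_top_of_nonempty ℝ V V hne]
  have hle := Submodule.finrank_le (vectorSpan ℝ X)
  rw [collinear_iff_finrank_le_one] at hX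
  refine Submodule.eq_top_of_finrank_eq ?_
  rw [(Fact.out : Module.finrank ℝ V = 2)] at hle ⊢
  omega

lemma many_interiorPoints_or_isExceptionalPair (hA : ¬ Collinear ℝ A) (hB : ¬ Collinear ℝ B)
    (hAfin : A.Finite) (hBfin : B.Finite) (hAb : A ⊆ boundaryPoints A)
    (hBb : B ⊆ boundaryPoints B) :
    A.ncard + B.ncard ≤ 2 * (interiorPoints (A + B)).ncard + 6 ∨
      IsExceptionalPair A B ∨ IsExceptionalPair B A := by
  have hA' := affineSpan_eq_top_of_not_collinear hA
  have hB' := affineSpan_eq_top_of_not_collinear hB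
  have hcomm : A + B = B + A := add_comm A B
  by_contra! ⟨hfew, hAB, hBA⟩
  have hA_ne : A.ncard ≠ 3 := fun h ↦
    hAB (isExceptionalPair_of_ncard_eq_three hA' hB' hBfin hBb h (by omega))
  have hB_ne : B.ncard ≠ 3 := fun h ↦
    hBA (isExceptionalPair_of_ncard_eq_three hB' hA' hAfin hAb h (by rw [← hcomm]; omega))
  have hA₃ := three_le_ncard_of_not_collinear hA hAfin
  have hB₃ := three_le_ncard_of_not_collinear hB hBfin
  rcases le_total A.ncard B.ncard with hle | hle
  · have := ncard_add_ncard_le_of_four_le hA' hB' hAfin hBfin hAb hBb (by omega) hle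
    omega
  · have := ncard_add_ncard_le_of_four_le hB' hA' hBfin hAfin hBb hAb (by omega) hle
    rw [← hcomm] at this
    omega

lemma sqrt_ncard_sub_two_add_sqrt_le (hA : ¬ Collinear ℝ A) (hB : ¬ Collinear ℝ B)
    (hAfin : A.Finite) (hBfin : B.Finite) (hAb : A ⊆ boundaryPoints A)
    (hBb : B ⊆ boundaryPoints B) :
    √((A.ncard : ℝ) - 2) + √((B.ncard : ℝ) - 2) ≤
      √(2 * ((interiorPoints (A + B)).ncard : ℝ) + (boundaryPoints (A + B)).ncard - 2) := by
  have hb : A.ncard + B.ncard ≤ (boundaryPoints (A + B)).ncard := by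
    have hle := ncard_boundaryPoints_add_le (affineSpan_eq_top_of_not_collinear hA)
      (affineSpan_eq_top_of_not_collinear hB) hAfin hBfin
    rwa [← hAb.antisymm inter_subset_left, ← hBb.antisymm inter_subset_left] at hle
  have hA₃ : (3 : ℝ) ≤ A.ncard := by exact_mod_cast three_le_ncard_of_not_collinear hA hAfin
  have hB₃ : (3 : ℝ) ≤ B.ncard := by exact_mod_cast three_le_ncard_of_not_collinear hB hBfin
  rcases many_interiorPoints_or_isExceptionalPair hA hB hAfin hBfin hAb hBb with hi | h | h
  · refine sqrt_add_sqrt_le_sqrt (by linarith) (by linarith) ?_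
    have hi' : (A.ncard : ℝ) + B.ncard ≤ 2 * (interiorPoints (A + B)).ncard + 6 := by
      exact_mod_cast hi
    have hb' : (A.ncard : ℝ) + B.ncard ≤ (boundaryPoints (A + B)).ncard := by exact_mod_cast hb
    linarith
  · exact h.sqrt_add_sqrt_le hb
  · rw [add_comm A B] at hb ⊢
    rw [add_comm √_]
    exact h.sqrt_add_sqrt_le (by rwa [add_comm B.ncard])

lemma cast_ncard_triangles {K : Geometry.SimplicialComplex ℝ V} (hfin : X.Finite)
    (hX : affineSpan ℝ X = ⊤) (hK : K.vertices = X ∧ K.space = convexHull ℝ X) :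
    ({s | s ∈ K.faces ∧ s.card = 3}.ncard : ℝ) =
      2 * ((interiorPoints X).ncard : ℝ) + (boundaryPoints X).ncard - 2 := by
  obtain ⟨rfl, hspace⟩ := hK
  rw [eq_sub_iff_add_eq]
  exact_mod_cast ncard_triangles_add_two hfin hspace hX

theorem theorem3_general (hA : A.Finite) (hB : B.Finite) (hAc : ¬ Collinear ℝ A)
    (hBc : ¬ Collinear ℝ B) (hAb : A.ncard = (boundaryPoints A).ncard)
    (hBb : B.ncard = (boundaryPoints B).ncard) :
    (¬ (2 * ((interiorPoints (A + B)).ncard : ℤ) ≥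
        (boundaryPoints A).ncard + (boundaryPoints B).ncard - 6) →
      (A.ncard = 3 ∧ ∃ t : V, B = t +ᵥ (A + A)) ∨ (B.ncard = 3 ∧ ∃ t : V, A = t +ᵥ (B + B))) ∧
    √(2 * ((interiorPoints (A + B)).ncard : ℝ) + (boundaryPoints (A + B)).ncard - 2) ≥
      √(2 * ((interiorPoints A).ncard : ℝ) + (boundaryPoints A).ncard - 2) +
        √(2 * ((interiorPoints B).ncard : ℝ) + (boundaryPoints B).ncard - 2) ∧
    ∀ KA KB KAB : Geometry.SimplicialComplex ℝ V,
      KA.vertices = A ∧ KA.space = convexHull ℝ A → KB.vertices = B ∧ KB.space = convexHull ℝ B →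
      KAB.vertices = A + B ∧ KAB.space = convexHull ℝ (A + B) →
      √({s | s ∈ KAB.faces ∧ s.card = 3}.ncard : ℝ) ≥
        √({s | s ∈ KA.faces ∧ s.card = 3}.ncard : ℝ) +
          √({s | s ∈ KB.faces ∧ s.card = 3}.ncard : ℝ) := by
  have hAs : A ⊆ boundaryPoints A := (eq_of_subset_of_ncard_le inter_subset_left hAb.le hA).superset
  have hBs : B ⊆ boundaryPoints B := (eq_of_subset_of_ncard_le inter_subset_left hBb.le hB).superset
  have hiA : (interiorPoints A).ncard = 0 := by
    have := ncard_boundaryPoints_add_ncard_interiorPoints hA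
    omega
  have hiB : (interiorPoints B).ncard = 0 := by
    have := ncard_boundaryPoints_add_ncard_interiorPoints hB
    omega
  have hA' := affineSpan_eq_top_of_not_collinear hAc
  have hB' := affineSpan_eq_top_of_not_collinear hBc
  have hAB' := affineSpan_add_eq_top hA' (nonempty_of_affineSpan_eq_top hB')
  have hsqrt := sqrt_ncard_sub_two_add_sqrt_le hAc hBc hA hB hAs hBs
  refine ⟨fun hfew ↦ ?_, ?_, fun KA KB KAB hKA hKB hKAB ↦ ?_⟩
  · rcases many_interiorPoints_or_isExceptionalPair hAc hBc hA hB hAs hBs with hi | h | h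
    · omega
    · exact .inl ⟨h.ncard_left, h.exists_eq_vadd⟩
    · exact .inr ⟨h.ncard_left, h.exists_eq_vadd⟩
  · simpa [hiA, hiB, ← hAb, ← hBb] using hsqrt
  · rw [cast_ncard_triangles hA hA' hKA, cast_ncard_triangles hB hB' hKB,
      cast_ncard_triangles (hA.add hB) hAB' hKAB]
    simpa [hiA, hiB, ← hAb, ← hBb] using hsqrt

end Planar

theorem theorem3 (A B : Set Plane) (hA : A.Finite) (hB : B.Finite)
    (hAc : ¬ Collinear ℝ A) (hBc : ¬ Collinear ℝ B)
    (hAb : A.ncard = boundaryCount A) (hBb : B.ncard = boundaryCount B) :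
    -- if `2 i_{A+B} ≥ b_A + b_B - 6` fails, then `A, B` is an exceptional pair
    (¬ (2 * (interiorCount (A + B) : ℤ) ≥ boundaryCount A + boundaryCount B - 6) →
      (A.ncard = 3 ∧ ∃ t : Plane, B = t +ᵥ (A + A)) ∨
      (B.ncard = 3 ∧ ∃ t : Plane, A = t +ᵥ (B + B))) ∧
    -- the conjectured inequality in terms of boundary and interior points
    √(2 * (interiorCount (A + B) : ℝ) + boundaryCount (A + B) - 2) ≥
      √(2 * (interiorCount A : ℝ) + boundaryCount A - 2) +
        √(2 * (interiorCount B : ℝ) + boundaryCount B - 2) ∧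
    -- the conjectured inequality in terms of the number of triangles in any triangulations
    (∀ KA KB KAB : Geometry.SimplicialComplex ℝ Plane,
      IsTriangulation A KA → IsTriangulation B KB → IsTriangulation (A + B) KAB →
      √(triangleCount KAB : ℝ) ≥ √(triangleCount KA : ℝ) + √(triangleCount KB : ℝ)) := by
  have : Fact (Module.finrank ℝ Plane = 2) := ⟨finrank_euclideanSpace_fin⟩
  exact theorem3_general hA hB hAc hBc hAb hBb
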